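/- Let $d\in\mathbb N$, $T>0$, and let $\Gamma$ be a nonnegative, tempered measure on $\mathbb R^d$ that is nonnegative definite, i.e. $\int (\varphi*\tilde\varphi)(x)\,\Gamma(dx)\ge 0$ for every complex-valued $\varphi\in C_0^\infty(\mathbb R^d)$, where $\tilde\varphi(x)=\overline{\varphi(-x)}$. For real functions $f,g$ on $\mathbb R^d$ that are Schwartz functions or bounded Borel functions with bounded support put $$\langle f,g\rangle_\Gamma=\int_{\mathbb R^d}(f*\tilde g)(x)\,\Gamma(dx).$$ Let $\mathcal H$ be the real Hilbert space obtained as the completion of the real Schwartz space $\mathcal S(\mathbb R^d)$ with respect to $\langle\cdot,\cdot\rangle_\Gamma$ (functions of norm zero being identified with $0$), and let $\mathcal H_T=L^2([0,T];\mathcal H)$. Let $(\Omega,\mathcal A,\mathbb P)$ be a probability space with a filtration $(\mathcal F_t)_{t\ge0}$. Let $\mathcal E$ be the space of simple processes, i.e. finite sums of $g(t,x;\omega)=1_{(a,b]}(t)1_A(x)X(\omega)$ with $0\le a<b\le T$, $A\subset\mathbb R^d$ a bounded Borel set and $X$ a bounded $\mathcal F_a$-measurable random variable, and let $\mathcal E_d$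 be the space of deterministic simple functions, i.e. finite sums of $c\,1_{(a,b]}(t)1_A(x)$ with $c\in\mathbb R$ and $a,b,A$ as before. Let $\mathcal P_0$ and $\mathcal P_{0,d}$ be the completions of $\mathcal E$ and $\mathcal E_d$ with respect to the (semi)norm $\|\cdot\|_0$ of the inner product $$\langle f,g\rangle_0=\mathbb E\Big[\int_0^T\langle f(t),g(t)\rangle_\Gamma\,dt\Big].$$ 1. The spaces $\mathcal P_{0,d}$ and $\mathcal H_T$ coincide: there is exactly one linear isometric bijection $\Phi:\mathcal P_{0,d}\to\mathcal H_T$ that identifies every $g\in\mathcal E_d$ with the $\mathcal H$-valued function $t\mapsto g(t,\cdot)$, in the sense that for all $\varphi\in\mathcal S(\mathbb R^d)$, $\langle \Phi(g)(t),\varphi\rangle_{\mathcal H}=\langle g(t),\varphi\rangle_\Gamma$ for a.e. $t\in[0,T]$. 2. The space $\mathcal P_0$ and the space of predictable processes in $L^2(\Omega\times[0,T];\mathcal H)$ (classes of processes equal $d\mathbb P\otimes dt$-a.e., with a predictable representative) coincide: there is exactly one linear isometric bijection $\Psi$ from the former onto the latter such that for all $g\in\mathcal E$ and $\varphi\in\mathcal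 S(\mathbb R^d)$, $\langle \Psi(g)(t,\omega),\varphi\rangle_{\mathcal H}=\langle g(t,\cdot\,;\omega),\varphi\rangle_\Gamma$ for a.e. $(t,\omega)$. Moreover, an element $x\in\mathcal P_0$ lies in the closure of the deterministic simple processes in $\mathcal P_0$ if and only if $\Psi(x)$ is deterministic, i.e. $\Psi(x)(t,\omega)=h(t)$ a.e. for some $h\in\mathcal H_T$. -/

import Mathlib

open MeasureTheory Filter Topology
open scoped NNReal ENNReal SchwartzMap Convolution ComplexConjugate ComplexOrder

noncomputable section

namespace SpatialNoise

/-- Euclidean space `ℝ^d`. -/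
abbrev Space (d : ℕ) : Type := EuclideanSpace ℝ (Fin d)

/-! ### The covariance measure `Γ` and the form `∫ (f ∗ g̃)(x) Γ(dx)` -/

/-- `Γ` is nonnegative definite: `∫ (φ ∗ φ̃)(x) Γ(dx) ≥ 0` for all complex-valued test functions
`φ ∈ C_0^∞(ℝ^d)`, with `φ̃(x) = conj (φ (-x))`. (`0 ≤ z` for a complex number `z` means that `z` is
real and nonnegative.) -/
def IsNonnegDefinite {d : ℕ} (Γ : Measure (Space d)) : Prop :=
  ∀ φ : Space d → ℂ, ContDiff ℝ (⊤ : ℕ∞) φ → HasCompactSupport φ →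
    0 ≤ ∫ x, (φ ⋆[ContinuousLinearMap.mul ℝ ℂ, volume] (fun y => conj (φ (-y)))) x ∂Γ

/-- The spatial covariance of the noise: a nonnegative, nonnegative definite, tempered measure `Γ`
on `ℝ^d`. -/
structure SpatialCovariance (d : ℕ) where
  /-- the (nonnegative Borel) measure `Γ` -/
  measure : Measure (Space d)
  tempered : measure.HasTemperateGrowth
  nonnegDefinite : IsNonnegDefinite measure

/-- The form `⟨f, g⟩ = ∫ (f ∗ g̃)(x) Γ(dx)`, `g̃(x) = g(-x)`, for real functions on `ℝ^d`. -/
def SpatialCovariance.form {d : ℕ} (Γ : SpatialCovariance d) (f g : Space d → ℝ) : ℝ :=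
  ∫ x, (f ⋆[ContinuousLinearMap.mul ℝ ℝ, volume] (fun y => g (-y))) x ∂Γ.measure

/-! ### Bounded, rapidly decreasing measurable functions

An auxiliary class that contains the Schwartz functions and the indicators of bounded Borel sets,
and on which the form is shown to be a positive semidefinite inner product. -/

/-- Measurable functions that decrease faster than any power of `1 / (1 + |x|)`. -/
def rapid (d : ℕ) : Submodule ℝ (Space d → ℝ) where
  carrier := {f | Measurable f ∧ ∀ k : ℕ, ∃ C, ∀ x, |f x| ≤ C * ((1 + ‖x‖) ^ k)⁻¹}
  zero_mem' := ⟨measurable_const, fun _ => ⟨0, fun x => by simp⟩⟩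
  add_mem' := by
    rintro f g ⟨hf, hf'⟩ ⟨hg, hg'⟩
    refine ⟨hf.add hg, fun k => ?_⟩
    obtain ⟨C, hC⟩ := hf' k
    obtain ⟨D, hD⟩ := hg' k
    refine ⟨C + D, fun x => ?_⟩
    have := abs_add_le (f x) (g x)
    simp only [Pi.add_apply]
    linarith [hC x, hD x, add_mul C D ((1 + ‖x‖) ^ k)⁻¹]
  smul_mem' := by
    rintro c f ⟨hf, hf'⟩
    refine ⟨hf.const_smul c, fun k => ?_⟩
    obtain ⟨C, hC⟩ := hf' k
    refine ⟨|c| * C, fun x => ?_⟩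
    simp only [Pi.smul_apply, smul_eq_mul, abs_mul, mul_assoc]
    exact mul_le_mul_of_nonneg_left (hC x) (abs_nonneg c)

lemma schwartz_mem_rapid {d : ℕ} (φ : 𝓢(Space d, ℝ)) : (φ : Space d → ℝ) ∈ rapid d := by
  refine ⟨φ.continuous.measurable, fun k => ?_⟩
  refine ⟨2 ^ k * ((Finset.Iic (k, 0)).sup fun m => SchwartzMap.seminorm ℝ m.1 m.2) φ,
    fun x => ?_⟩
  have h := SchwartzMap.one_add_le_sup_seminorm_apply (𝕜 := ℝ) (m := (k, 0)) le_rfl le_rfl φ x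
  rw [norm_iteratedFDeriv_zero, Real.norm_eq_abs] at h
  have hp : 0 < (1 + ‖x‖) ^ k := by positivity
  rw [← div_eq_mul_inv, le_div_iff₀ hp, mul_comm]
  exact h

lemma indicator_mem_rapid {d : ℕ} {A : Set (Space d)} (hA : MeasurableSet A)
    (hb : Bornology.IsBounded A) : A.indicator (fun _ => (1 : ℝ)) ∈ rapid d := by
  refine ⟨measurable_const.indicator hA, fun k => ?_⟩
  obtain ⟨R, hR⟩ := hb.exists_norm_le
  refine ⟨(1 + |R|) ^ k, fun x => ?_⟩
  have hp : 0 < (1 + ‖x‖) ^ k := by positivity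
  rw [← div_eq_mul_inv, le_div_iff₀ hp]
  by_cases hx : x ∈ A
  · simp only [Set.indicator_of_mem hx, abs_one, one_mul]
    gcongr
    exact (hR x hx).trans (le_abs_self R)
  · simp only [Set.indicator_of_notMem hx, abs_zero, zero_mul]
    positivity

namespace SpatialCovariance

variable {d : ℕ} (Γ : SpatialCovariance d)

lemma form_eq (f g : Space d → ℝ) :
    Γ.form f g = ∫ x, (∫ y, f y * g (y - x)) ∂Γ.measure := by
  simp [form, convolution, neg_sub]

/-- Exponents for which the weights are integrable against Lebesgue measure and `Γ`. -/
lemma exists_weights : ∃ m n : ℕ,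
    Integrable (fun x : Space d => ((1 + ‖x‖) ^ m)⁻¹) ∧
    Integrable (fun x : Space d => ((1 + ‖x‖) ^ n)⁻¹) Γ.measure := by
  have h (μ : Measure (Space d)) (hμ : μ.HasTemperateGrowth) :
      ∃ n : ℕ, Integrable (fun x : Space d => ((1 + ‖x‖) ^ n)⁻¹) μ := by
    obtain ⟨n, hn⟩ := hμ.exists_integrable
    refine ⟨n, hn.congr (Eventually.of_forall fun x => ?_)⟩
    simp only
    rw [Real.rpow_neg (by positivity), Real.rpow_natCast]
  obtain ⟨m, hm⟩ := h volume inferInstance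
  obtain ⟨n, hn⟩ := h Γ.measure Γ.tempered
  exact ⟨m, n, hm, hn⟩

lemma weight_mul_le (m n : ℕ) (x y : Space d) :
    ((1 + ‖y‖) ^ (m + n))⁻¹ * ((1 + ‖y - x‖) ^ (m + n))⁻¹ ≤
      ((1 + ‖x‖) ^ n)⁻¹ * ((1 + ‖y‖) ^ m)⁻¹ := by
  rw [← mul_inv, ← mul_inv]
  refine inv_anti₀ (by positivity) ?_
  have h1 : 1 + ‖x‖ ≤ (1 + ‖y‖) * (1 + ‖y - x‖) := by
    have : ‖x‖ ≤ ‖y‖ + ‖y - x‖ := by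
      have := norm_sub_le y (y - x)
      rwa [sub_sub_cancel] at this
    nlinarith [norm_nonneg y, norm_nonneg (y - x)]
  have h2 : (1 + ‖x‖) ^ n ≤ (1 + ‖y‖) ^ n * (1 + ‖y - x‖) ^ n := by
    rw [← mul_pow]; gcongr
  have h3 : 1 ≤ (1 + ‖y - x‖) ^ m := one_le_pow₀ (by linarith [norm_nonneg (y - x)])
  calc (1 + ‖x‖) ^ n * (1 + ‖y‖) ^ m
      ≤ ((1 + ‖y‖) ^ n * (1 + ‖y - x‖) ^ n) * (1 + ‖y‖) ^ m := by gcongr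
    _ ≤ ((1 + ‖y‖) ^ n * (1 + ‖y - x‖) ^ n) * (1 + ‖y‖) ^ m * (1 + ‖y - x‖) ^ m :=
        le_mul_of_one_le_right (by positivity) h3
    _ = (1 + ‖y‖) ^ (m + n) * (1 + ‖y - x‖) ^ (m + n) := by ring

lemma prod_bound {f g : Space d → ℝ} {C : ℝ} {m n : ℕ}
    (hf : ∀ x, |f x| ≤ C * ((1 + ‖x‖) ^ (m + n))⁻¹)
    (hg : ∀ x, |g x| ≤ C * ((1 + ‖x‖) ^ (m + n))⁻¹) (x y : Space d) :
    ‖f y * g (y - x)‖ ≤ C ^ 2 * ((1 + ‖x‖) ^ n)⁻¹ * ((1 + ‖y‖) ^ m)⁻¹ := by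
  rw [norm_mul, Real.norm_eq_abs, Real.norm_eq_abs]
  calc |f y| * |g (y - x)|
      ≤ (C * ((1 + ‖y‖) ^ (m + n))⁻¹) * (C * ((1 + ‖y - x‖) ^ (m + n))⁻¹) :=
        mul_le_mul (hf y) (hg _) (abs_nonneg _) ((abs_nonneg _).trans (hf y))
    _ = C ^ 2 * (((1 + ‖y‖) ^ (m + n))⁻¹ * ((1 + ‖y - x‖) ^ (m + n))⁻¹) := by ring
    _ ≤ C ^ 2 * (((1 + ‖x‖) ^ n)⁻¹ * ((1 + ‖y‖) ^ m)⁻¹) := by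
        exact mul_le_mul_of_nonneg_left (weight_mul_le m n x y) (sq_nonneg C)
    _ = _ := by ring

lemma exists_common_bound {f g : Space d → ℝ} (hf : f ∈ rapid d) (hg : g ∈ rapid d) (k : ℕ) :
    ∃ C, (∀ x, |f x| ≤ C * ((1 + ‖x‖) ^ k)⁻¹) ∧ ∀ x, |g x| ≤ C * ((1 + ‖x‖) ^ k)⁻¹ := by
  obtain ⟨C, hC⟩ := hf.2 k
  obtain ⟨D, hD⟩ := hg.2 k
  exact ⟨max C D, fun x => (hC x).trans (by gcongr; exact le_max_left _ _),
    fun x => (hD x).trans (by gcongr; exact le_max_right _ _)⟩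

lemma measurable_shift {f g : Space d → ℝ} (hf : Measurable f) (hg : Measurable g) :
    Measurable (Function.uncurry fun x y : Space d => f y * g (y - x)) := by
  unfold Function.uncurry
  fun_prop

lemma integrable_inner (Γ : SpatialCovariance d) {f g : Space d → ℝ} (hf : f ∈ rapid d) (hg : g ∈ rapid d) (x : Space d) :
    Integrable (fun y => f y * g (y - x)) := by
  obtain ⟨m, -, hm, -⟩ := (Γ.exists_weights)
  obtain ⟨C, hC, hD⟩ := exists_common_bound hf hg (m + 0)
  refine Integrable.mono' (hm.const_mul (C ^ 2 * ((1 + ‖x‖) ^ 0)⁻¹)) ?_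
    (Eventually.of_forall fun y => prod_bound hC hD x y)
  have := hf.1
  have := hg.1
  exact Measurable.aestronglyMeasurable (by fun_prop)

lemma integrable_outer {f g : Space d → ℝ} (hf : f ∈ rapid d) (hg : g ∈ rapid d) :
    Integrable (fun x => ∫ y, f y * g (y - x)) Γ.measure := by
  obtain ⟨m, n, hm, hn⟩ := Γ.exists_weights
  obtain ⟨C, hC, hD⟩ := exists_common_bound hf hg (m + n)
  refine Integrable.mono' (hn.const_mul (C ^ 2 * ∫ y : Space d, ((1 + ‖y‖) ^ m)⁻¹)) ?_
    (Eventually.of_forall fun x => ?_)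
  · exact ((measurable_shift hf.1 hg.1).stronglyMeasurable.integral_prod_right).aestronglyMeasurable
  · refine (norm_integral_le_of_norm_le (hm.const_mul _)
      (Eventually.of_forall fun y => prod_bound hC hD x y)).trans_eq ?_
    rw [integral_const_mul]; ring

lemma form_add_left {f g h : Space d → ℝ} (hf : f ∈ rapid d) (hg : g ∈ rapid d)
    (hh : h ∈ rapid d) : Γ.form (f + g) h = Γ.form f h + Γ.form g h := by
  simp only [form_eq]
  rw [← integral_add (Γ.integrable_outer hf hh) (Γ.integrable_outer hg hh)]
  congr 1; ext x
  rw [← integral_add (Γ.integrable_inner hf hh x) (Γ.integrable_inner hg hh x)]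
  congr 1; ext y
  simp [add_mul]

lemma form_smul_left (c : ℝ) (f h : Space d → ℝ) : Γ.form (c • f) h = c * Γ.form f h := by
  simp only [form_eq, ← integral_const_mul, Pi.smul_apply, smul_eq_mul, mul_assoc]

/-- Dominated convergence for the form. -/
lemma tendsto_form {m n : ℕ} (hm : Integrable (fun x : Space d => ((1 + ‖x‖) ^ m)⁻¹))
    (hn : Integrable (fun x : Space d => ((1 + ‖x‖) ^ n)⁻¹) Γ.measure)
    {F G : ℕ → Space d → ℝ} {f g : Space d → ℝ} {C : ℝ}
    (hFm : ∀ i, Measurable (F i)) (hGm : ∀ i, Measurable (G i))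
    (hF : ∀ i x, |F i x| ≤ C * ((1 + ‖x‖) ^ (m + n))⁻¹)
    (hG : ∀ i x, |G i x| ≤ C * ((1 + ‖x‖) ^ (m + n))⁻¹)
    (hFf : ∀ᵐ x, Tendsto (fun i => F i x) atTop (𝓝 (f x)))
    (hGg : ∀ᵐ x, Tendsto (fun i => G i x) atTop (𝓝 (g x))) :
    Tendsto (fun i => Γ.form (F i) (G i)) atTop (𝓝 (Γ.form f g)) := by
  simp only [form_eq]
  refine tendsto_integral_of_dominated_convergence
    (fun x => (C ^ 2 * ∫ y : Space d, ((1 + ‖y‖) ^ m)⁻¹) * ((1 + ‖x‖) ^ n)⁻¹)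
    (fun i => ?_) (hn.const_mul _) (fun i => Eventually.of_forall fun x => ?_)
    (Eventually.of_forall fun x => ?_)
  · exact ((measurable_shift (hFm i) (hGm i)).stronglyMeasurable.integral_prod_right).aestronglyMeasurable
  · refine (norm_integral_le_of_norm_le (hm.const_mul _)
      (Eventually.of_forall fun y => prod_bound (hF i) (hG i) x y)).trans_eq ?_
    rw [integral_const_mul]; ring
  · refine tendsto_integral_of_dominated_convergence
      (fun y => C ^ 2 * ((1 + ‖x‖) ^ n)⁻¹ * ((1 + ‖y‖) ^ m)⁻¹)
      (fun i => ?_) (hm.const_mul _)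
      (fun i => Eventually.of_forall fun y => prod_bound (hF i) (hG i) x y) ?_
    · have := hFm i
      have := hGm i
      exact Measurable.aestronglyMeasurable (by fun_prop)
    · have h2 : ∀ᵐ y, Tendsto (fun i => G i (y - x)) atTop (𝓝 (g (y - x))) :=
        (measurePreserving_sub_right volume x).quasiMeasurePreserving.ae hGg
      filter_upwards [hFf, h2] with y h1 h2 using h1.mul h2

/-- Approximation by test functions, dominated by a rapidly decreasing function. -/
lemma exists_approx {f : Space d → ℝ} (hf : f ∈ rapid d) (k : ℕ) :
    ∃ (F : ℕ → Space d → ℝ) (C : ℝ), (∀ i, ContDiff ℝ (⊤ : ℕ∞) (F i)) ∧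
      (∀ i, HasCompactSupport (F i)) ∧ (∀ i x, |F i x| ≤ C * ((1 + ‖x‖) ^ k)⁻¹) ∧
      ∀ᵐ x, Tendsto (fun i => F i x) atTop (𝓝 (f x)) := by
  obtain ⟨C, hC⟩ := hf.2 k
  have hC0 : 0 ≤ C := by
    have := (abs_nonneg _).trans (hC 0)
    simpa using this
  obtain ⟨C', hC'⟩ := hf.2 0
  have hloc : LocallyIntegrable f := by
    refine LocallyIntegrable.mono (locallyIntegrable_const (C' : ℝ))
      hf.1.aestronglyMeasurable (Eventually.of_forall fun x => ?_)
    have := hC' x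
    simp only [pow_zero, inv_one, mul_one] at this
    exact this.trans (le_abs_self C')
  let ζ : ℕ → ContDiffBump (0 : Space d) := fun i =>
    { rIn := 1 / (i + 1 : ℝ) / 2, rOut := 1 / (i + 1 : ℝ), rIn_pos := by positivity,
      rIn_lt_rOut := half_lt_self (by positivity) }
  let χ : ℕ → ContDiffBump (0 : Space d) := fun i =>
    { rIn := i + 1, rOut := i + 2, rIn_pos := by positivity, rIn_lt_rOut := by linarith }
  let S : ℕ → Space d → ℝ := fun i =>
    (ζ i).normed volume ⋆[ContinuousLinearMap.lsmul ℝ ℝ, volume] f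
  have hSbound : ∀ i x, |S i x| ≤ C * 2 ^ k * ((1 + ‖x‖) ^ k)⁻¹ := by
    intro i x
    have hb : dist (S i x) 0 ≤ C * 2 ^ k * ((1 + ‖x‖) ^ k)⁻¹ := by
      refine dist_convolution_le (by positivity) (ζ i).support_normed_eq.subset
        (ζ i).nonneg_normed (ζ i).integral_normed hf.1.aestronglyMeasurable fun y hy => ?_
      rw [dist_zero_right, Real.norm_eq_abs]
      refine (hC y).trans ?_
      rw [mul_assoc]
      refine mul_le_mul_of_nonneg_left ?_ hC0
      rw [← div_eq_mul_inv, le_div_iff₀ (by positivity), inv_mul_le_iff₀ (by positivity),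
        ← mul_pow]
      have h1 : (ζ i).rOut ≤ 1 := by
        change 1 / (i + 1 : ℝ) ≤ 1
        rw [div_le_one (by positivity)]
        linarith [Nat.cast_nonneg (α := ℝ) i]
      have h2 : ‖x‖ ≤ ‖y‖ + 1 := by
        have h3 : dist y x < (ζ i).rOut := Metric.mem_ball.1 hy
        rw [dist_eq_norm] at h3
        have h4 := norm_sub_le y (y - x)
        rw [sub_sub_cancel] at h4
        linarith
      gcongr
      linarith [norm_nonneg y]
    simpa [dist_zero_right] using hb
  refine ⟨fun i x => χ i x * S i x, C * 2 ^ k, fun i => ?_, fun i => ?_, fun i x => ?_, ?_⟩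
  · exact (χ i).contDiff.mul
      ((ζ i).hasCompactSupport_normed.contDiff_convolution_left _ (ζ i).contDiff_normed hloc)
  · exact (χ i).hasCompactSupport.mul_right
  · rw [abs_mul, abs_of_nonneg (χ i).nonneg]
    exact (mul_le_of_le_one_left (abs_nonneg _) (χ i).le_one).trans (hSbound i x)
  · have hlim := ContDiffBump.ae_convolution_tendsto_right_of_locallyIntegrable
      (φ := ζ) (l := atTop) (K := 2) (μ := volume) tendsto_one_div_add_atTop_nhds_zero_nat
      (Eventually.of_forall fun i => by
        change 1 / (i + 1 : ℝ) ≤ 2 * (1 / (i + 1 : ℝ) / 2)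
        linarith) hloc
    filter_upwards [hlim] with x hx
    refine hx.congr' ?_
    obtain ⟨N, hN⟩ := exists_nat_ge ‖x‖
    filter_upwards [eventually_ge_atTop N] with i hi
    have h1 : χ i x = 1 := by
      refine (χ i).one_of_mem_closedBall ?_
      rw [mem_closedBall_zero_iff]
      change ‖x‖ ≤ (i : ℝ) + 1
      have : (N : ℝ) ≤ i := by exact_mod_cast hi
      linarith
    rw [h1, one_mul]

lemma test_mem_rapid {φ : Space d → ℝ} (hφ : ContDiff ℝ (⊤ : ℕ∞) φ) (hc : HasCompactSupport φ) :
    φ ∈ rapid d :=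
  schwartz_mem_rapid (hc.toSchwartzMap hφ)

/-- Symmetry and positivity on test functions. -/
lemma form_test {φ ψ : Space d → ℝ} (hφ : ContDiff ℝ (⊤ : ℕ∞) φ) (hφc : HasCompactSupport φ)
    (hψ : ContDiff ℝ (⊤ : ℕ∞) ψ) (hψc : HasCompactSupport ψ) :
    0 ≤ Γ.form φ φ + Γ.form ψ ψ ∧ Γ.form φ ψ = Γ.form ψ φ := by
  have h1 := test_mem_rapid hφ hφc
  have h2 := test_mem_rapid hψ hψc
  have key := Γ.nonnegDefinite (fun x => (φ x : ℂ) + (ψ x : ℂ) * Complex.I)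
    ((Complex.ofRealCLM.contDiff.comp hφ).add
      ((Complex.ofRealCLM.contDiff.comp hψ).mul contDiff_const))
    ((hφc.comp_left (g := fun r : ℝ => (r : ℂ)) (by simp)).add
      ((hψc.comp_left (g := fun r : ℝ => (r : ℂ)) (by simp)).mul_right))
  have hconv : ∀ x, ((fun x => (φ x : ℂ) + (ψ x : ℂ) * Complex.I)
      ⋆[ContinuousLinearMap.mul ℝ ℂ, volume]
        (fun y => conj ((φ (-y) : ℂ) + (ψ (-y) : ℂ) * Complex.I))) x =
      (((∫ y, φ y * φ (y - x)) + ∫ y, ψ y * ψ (y - x) : ℝ) : ℂ) +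
      (((∫ y, ψ y * φ (y - x)) - ∫ y, φ y * ψ (y - x) : ℝ) : ℂ) * Complex.I := by
    intro x
    rw [← integral_add (Γ.integrable_inner h1 h1 x) (Γ.integrable_inner h2 h2 x),
      ← integral_sub (Γ.integrable_inner h2 h1 x) (Γ.integrable_inner h1 h2 x),
      ← integral_complex_ofReal, ← integral_complex_ofReal, ← integral_mul_const,
      ← integral_add]
    · unfold convolution
      congr 1; ext y
      rw [ContinuousLinearMap.mul_apply']
      simp only [neg_sub, map_add, map_mul, Complex.conj_ofReal,
        Complex.conj_I]
      push_cast
      linear_combination (-(ψ y * ψ (y - x) : ℂ)) * Complex.I_mul_I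
    · exact ((Γ.integrable_inner h1 h1 x).add (Γ.integrable_inner h2 h2 x)).ofReal
    · exact ((Γ.integrable_inner h2 h1 x).sub (Γ.integrable_inner h1 h2 x)).ofReal.mul_const _
  simp only [hconv] at key
  rw [integral_add, integral_mul_const, integral_complex_ofReal, integral_complex_ofReal,
    integral_add (Γ.integrable_outer h1 h1) (Γ.integrable_outer h2 h2),
    integral_sub (Γ.integrable_outer h2 h1) (Γ.integrable_outer h1 h2)] at key
  · simp only [← form_eq] at key
    rw [Complex.le_def] at key
    simp only [Complex.zero_re, Complex.zero_im, Complex.add_re, Complex.add_im, Complex.mul_re,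
      Complex.mul_im, Complex.ofReal_re, Complex.ofReal_im, Complex.I_re, Complex.I_im, mul_zero,
      mul_one, sub_zero, zero_add, add_zero] at key
    exact ⟨key.1, by linarith [key.2]⟩
  · exact ((Γ.integrable_outer h1 h1).add (Γ.integrable_outer h2 h2)).ofReal
  · exact ((Γ.integrable_outer h2 h1).sub (Γ.integrable_outer h1 h2)).ofReal.mul_const _

lemma form_symm_and_nonneg {f g : Space d → ℝ} (hf : f ∈ rapid d) (hg : g ∈ rapid d) :
    Γ.form f g = Γ.form g f ∧ 0 ≤ Γ.form f f := by
  obtain ⟨m, n, hm, hn⟩ := Γ.exists_weights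
  obtain ⟨F, C, hF, hFc, hFb, hFl⟩ := exists_approx hf (m + n)
  obtain ⟨G, D, hG, hGc, hGb, hGl⟩ := exists_approx hg (m + n)
  have hFb' : ∀ i x, |F i x| ≤ max C D * ((1 + ‖x‖) ^ (m + n))⁻¹ := fun i x =>
    (hFb i x).trans (by gcongr; exact le_max_left _ _)
  have hGb' : ∀ i x, |G i x| ≤ max C D * ((1 + ‖x‖) ^ (m + n))⁻¹ := fun i x =>
    (hGb i x).trans (by gcongr; exact le_max_right _ _)
  have mF := fun i => (hF i).continuous.measurable
  have mG := fun i => (hG i).continuous.measurable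
  constructor
  · refine tendsto_nhds_unique (Γ.tendsto_form hm hn mF mG hFb' hGb' hFl hGl) ?_
    refine (Γ.tendsto_form hm hn mG mF hGb' hFb' hGl hFl).congr fun i => ?_
    exact (Γ.form_test (hG i) (hGc i) (hF i) (hFc i)).2
  · refine ge_of_tendsto' (Γ.tendsto_form hm hn mF mF hFb' hFb' hFl hFl) fun i => ?_
    have := (Γ.form_test (hF i) (hFc i) (hF i) (hFc i)).1
    linarith

/-! ### The space `H`: completion of the Schwartz functions -/

/-- The real Schwartz functions, endowed below with the inner product
`⟨φ, ψ⟩_0 = ∫ (φ ∗ ψ̃)(x) Γ(dx)`. -/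
def SchwartzPre (_Γ : SpatialCovariance d) : Type := 𝓢(Space d, ℝ)

instance : AddCommGroup Γ.SchwartzPre := inferInstanceAs (AddCommGroup 𝓢(Space d, ℝ))

instance : Module ℝ Γ.SchwartzPre := inferInstanceAs (Module ℝ 𝓢(Space d, ℝ))

/-- The underlying Schwartz function. -/
def SchwartzPre.toSchwartz {Γ : SpatialCovariance d} (φ : Γ.SchwartzPre) : 𝓢(Space d, ℝ) := φ

/-- The inner product `⟨φ, ψ⟩_0 = ∫ (φ ∗ ψ̃)(x) Γ(dx)` on Schwartz functions. -/
@[reducible] def schwartzCore : PreInnerProductSpace.Core ℝ Γ.SchwartzPre where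
  inner φ ψ := Γ.form φ.toSchwartz ψ.toSchwartz
  conj_inner_symm φ ψ :=
    (Γ.form_symm_and_nonneg (schwartz_mem_rapid ψ.toSchwartz) (schwartz_mem_rapid φ.toSchwartz)).1
  re_inner_nonneg φ :=
    (Γ.form_symm_and_nonneg (schwartz_mem_rapid φ.toSchwartz) (schwartz_mem_rapid φ.toSchwartz)).2
  add_left φ ψ η := Γ.form_add_left (schwartz_mem_rapid φ.toSchwartz)
    (schwartz_mem_rapid ψ.toSchwartz) (schwartz_mem_rapid η.toSchwartz)
  smul_left φ ψ c := Γ.form_smul_left c φ.toSchwartz ψ.toSchwartz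

instance : SeminormedAddCommGroup Γ.SchwartzPre :=
  @InnerProductSpace.Core.toSeminormedAddCommGroup ℝ _ _ _ _ Γ.schwartzCore

instance : InnerProductSpace ℝ Γ.SchwartzPre := InnerProductSpace.ofCore Γ.schwartzCore

/-- The real Hilbert space `H`: the (Hausdorff) completion of the Schwartz functions with respect to
`⟨·,·⟩_0`. -/
abbrev H : Type := UniformSpace.Completion Γ.SchwartzPre

/-- The canonical map from the Schwartz functions to `H`. -/
def ofSchwartz (φ : 𝓢(Space d, ℝ)) : Γ.H := ((show Γ.SchwartzPre from φ : Γ.SchwartzPre) : Γ.H)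

/-! ### Inner products on spaces of random or time-dependent simple functions -/

/-- Finite sums of functions `(y, x) ↦ u(y) 1_A(x)`, with `u` bounded measurable and `A` a bounded
Borel set. -/
def elementary (Y : Type*) [MeasurableSpace Y] (d : ℕ) : Submodule ℝ (Y → Space d → ℝ) :=
  Submodule.span ℝ {g | ∃ (u : Y → ℝ) (A : Set (Space d)), Measurable u ∧ (∃ C, ∀ y, |u y| ≤ C) ∧
    MeasurableSet A ∧ Bornology.IsBounded A ∧
    g = fun y x => u y * A.indicator (fun _ => (1 : ℝ)) x}

lemma elementary_rapid {Y : Type*} [MeasurableSpace Y] {g : Y → Space d → ℝ}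
    (hg : g ∈ elementary Y d) (y : Y) : g y ∈ rapid d := by
  induction hg using Submodule.span_induction with
  | mem g hg =>
    obtain ⟨u, A, -, -, hA, hb, rfl⟩ := hg
    exact (rapid d).smul_mem (u y) (indicator_mem_rapid hA hb)
  | zero => exact (rapid d).zero_mem
  | add f g _ _ hf hg => exact (rapid d).add_mem hf hg
  | smul c f _ hf => exact (rapid d).smul_mem c hf

lemma form_symm {f g : Space d → ℝ} (hf : f ∈ rapid d) (hg : g ∈ rapid d) :
    Γ.form f g = Γ.form g f :=
  (Γ.form_symm_and_nonneg hf hg).1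

lemma elementary_integrable {Y : Type*} [MeasurableSpace Y] (ν : Measure Y) [IsFiniteMeasure ν]
    {f g : Y → Space d → ℝ} (hf : f ∈ elementary Y d) (hg : g ∈ elementary Y d) :
    Integrable (fun y => Γ.form (f y) (g y)) ν := by
  have add_right : ∀ {a b c : Space d → ℝ}, a ∈ rapid d → b ∈ rapid d → c ∈ rapid d →
      Γ.form a (b + c) = Γ.form a b + Γ.form a c := fun ha hb hc => by
    rw [Γ.form_symm ha ((rapid d).add_mem hb hc), Γ.form_add_left hb hc ha, Γ.form_symm hb ha,
      Γ.form_symm hc ha]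
  have smul_right : ∀ {a b : Space d → ℝ} (r : ℝ), a ∈ rapid d → b ∈ rapid d →
      Γ.form a (r • b) = r * Γ.form a b := fun r ha hb => by
    rw [Γ.form_symm ha ((rapid d).smul_mem r hb), Γ.form_smul_left, Γ.form_symm hb ha]
  have zero_left : ∀ a : Space d → ℝ, Γ.form 0 a = 0 := fun a => by
    simpa using Γ.form_smul_left 0 0 a
  induction hf using Submodule.span_induction with
  | zero => simp [zero_left]
  | add f₁ f₂ h₁ h₂ ih₁ ih₂ =>
    refine (ih₁.add ih₂).congr (Eventually.of_forall fun y => ?_)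
    exact (Γ.form_add_left (elementary_rapid h₁ y) (elementary_rapid h₂ y)
      (elementary_rapid hg y)).symm
  | smul c f₁ h₁ ih =>
    refine (ih.const_mul c).congr (Eventually.of_forall fun y => ?_)
    exact (Γ.form_smul_left c (f₁ y) (g y)).symm
  | mem f hf =>
    have hf' : f ∈ elementary Y d := Submodule.subset_span hf
    induction hg using Submodule.span_induction with
    | zero =>
      refine (integrable_zero Y ℝ ν).congr (Eventually.of_forall fun y => ?_)
      have := Γ.form_symm (elementary_rapid hf' y) (rapid d).zero_mem
      rw [zero_left] at this
      exact this.symm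
    | add g₁ g₂ h₁ h₂ ih₁ ih₂ =>
      refine (ih₁.add ih₂).congr (Eventually.of_forall fun y => ?_)
      exact (add_right (elementary_rapid hf' y) (elementary_rapid h₁ y)
        (elementary_rapid h₂ y)).symm
    | smul c g₁ h₁ ih =>
      refine (ih.const_mul c).congr (Eventually.of_forall fun y => ?_)
      exact (smul_right c (elementary_rapid hf' y) (elementary_rapid h₁ y)).symm
    | mem g hg =>
      obtain ⟨u, A, hu, ⟨C, hC⟩, hA, hAb, rfl⟩ := hf
      obtain ⟨v, B, hv, ⟨D, hD⟩, hB, hBb, rfl⟩ := hg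
      have hAr := indicator_mem_rapid hA hAb
      have hBr := indicator_mem_rapid hB hBb
      have h : Integrable (fun y => u y * v y *
          Γ.form (A.indicator fun _ => (1 : ℝ)) (B.indicator fun _ => (1 : ℝ))) ν := by
        refine Integrable.mul_const ?_ _
        refine Integrable.of_bound (hu.mul hv).aestronglyMeasurable (C * D)
          (Eventually.of_forall fun y => ?_)
        rw [Real.norm_eq_abs, abs_mul]
        exact mul_le_mul (hC y) (hD y) (abs_nonneg _) ((abs_nonneg _).trans (hC y))
      refine h.congr (Eventually.of_forall fun y => ?_)
      have := Γ.form_smul_left (u y) (A.indicator fun _ => (1 : ℝ))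
        (v y • B.indicator fun _ => (1 : ℝ))
      rw [smul_right (v y) hAr hBr, ← mul_assoc] at this
      exact this.symm

/-- The inner product `⟨f, g⟩ = ∫ ⟨f(y), g(y)⟩ ν(dy)`, with `⟨f(y), g(y)⟩` the form given by `Γ`, on a
space of elementary functions. -/
@[reducible] def integralCore {Y : Type*} [MeasurableSpace Y] (ν : Measure Y) [IsFiniteMeasure ν]
    (V : Submodule ℝ (Y → Space d → ℝ)) (hV : V ≤ elementary Y d) :
    PreInnerProductSpace.Core ℝ V where
  inner f g := ∫ y, Γ.form (f.1 y) (g.1 y) ∂ν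
  conj_inner_symm f g := integral_congr_ae <| Eventually.of_forall fun y =>
    Γ.form_symm (elementary_rapid (hV g.2) y) (elementary_rapid (hV f.2) y)
  re_inner_nonneg f := integral_nonneg fun y =>
    (Γ.form_symm_and_nonneg (elementary_rapid (hV f.2) y) (elementary_rapid (hV f.2) y)).2
  add_left f g h := by
    rw [← integral_add (Γ.elementary_integrable ν (hV f.2) (hV h.2))
      (Γ.elementary_integrable ν (hV g.2) (hV h.2))]
    exact integral_congr_ae <| Eventually.of_forall fun y =>
      Γ.form_add_left (elementary_rapid (hV f.2) y) (elementary_rapid (hV g.2) y)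
        (elementary_rapid (hV h.2) y)
  smul_left f g c := by
    refine Eq.trans ?_ (integral_const_mul c _)
    exact integral_congr_ae <| Eventually.of_forall fun y => Γ.form_smul_left c (f.1 y) (g.1 y)

end SpatialCovariance

/-! ### Simple functions and simple processes -/

/-- Lebesgue measure on `[0, T]`, as a measure on the time axis `ℝ≥0`. -/
def timeMeasure (T : ℝ≥0) : Measure ℝ≥0 :=
  Measure.map Real.toNNReal (volume.restrict (Set.Icc 0 (T : ℝ)))

instance (T : ℝ≥0) : IsFiniteMeasure (timeMeasure T) := by
  unfold timeMeasure
  infer_instance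

/-- Deterministic simple functions: finite sums of `(t, x) ↦ c 1_{(a,b]}(t) 1_A(x)`, with
`0 ≤ a < b ≤ T`, `A` a bounded Borel set and `c` a real number. -/
def simpleFunctions (d : ℕ) (T : ℝ≥0) : Submodule ℝ (ℝ≥0 → Space d → ℝ) :=
  Submodule.span ℝ {g | ∃ (a b : ℝ≥0) (A : Set (Space d)), a < b ∧ b ≤ T ∧
    MeasurableSet A ∧ Bornology.IsBounded A ∧
    g = fun t x => (Set.Ioc a b).indicator (fun _ => (1 : ℝ)) t * A.indicator (fun _ => (1 : ℝ)) x}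

/-- Simple processes: finite sums of `(t, ω, x) ↦ 1_{(a,b]}(t) 1_A(x) X(ω)`, with `0 ≤ a < b ≤ T`,
`A` a bounded Borel set and `X` a bounded `𝓕 a`-measurable random variable. -/
def simpleProcesses (d : ℕ) (T : ℝ≥0) {Ω : Type*} {mΩ : MeasurableSpace Ω}
    (𝓕 : Filtration ℝ≥0 mΩ) : Submodule ℝ (ℝ≥0 × Ω → Space d → ℝ) :=
  Submodule.span ℝ {g | ∃ (a b : ℝ≥0) (A : Set (Space d)) (X : Ω → ℝ), a < b ∧ b ≤ T ∧
    MeasurableSet A ∧ Bornology.IsBounded A ∧ Measurable[𝓕 a] X ∧ (∃ C, ∀ ω, |X ω| ≤ C) ∧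
    g = fun p x => (Set.Ioc a b).indicator (fun _ => (1 : ℝ)) p.1 *
      A.indicator (fun _ => (1 : ℝ)) x * X p.2}

lemma simpleFunctions_le (d : ℕ) (T : ℝ≥0) :
    simpleFunctions d T ≤ SpatialCovariance.elementary ℝ≥0 d := by
  refine Submodule.span_mono ?_
  rintro g ⟨a, b, A, -, -, hA, hb, rfl⟩
  refine ⟨_, A, measurable_const.indicator measurableSet_Ioc, ⟨1, fun t => ?_⟩, hA, hb, rfl⟩
  by_cases h : t ∈ Set.Ioc a b <;> simp [h]

lemma simpleProcesses_le (d : ℕ) (T : ℝ≥0) {Ω : Type*} {mΩ : MeasurableSpace Ω}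
    (𝓕 : Filtration ℝ≥0 mΩ) :
    simpleProcesses d T 𝓕 ≤ SpatialCovariance.elementary (ℝ≥0 × Ω) d := by
  refine Submodule.span_mono ?_
  rintro g ⟨a, b, A, X, -, -, hA, hb, hX, ⟨C, hC⟩, rfl⟩
  refine ⟨fun p => (Set.Ioc a b).indicator (fun _ => (1 : ℝ)) p.1 * X p.2, A, ?_,
    ⟨C, fun p => ?_⟩, hA, hb, ?_⟩
  · exact ((measurable_const.indicator measurableSet_Ioc).comp measurable_fst).mul
      ((hX.mono (𝓕.le a) le_rfl).comp measurable_snd)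
  · by_cases h : p.1 ∈ Set.Ioc a b
    · simpa [h] using hC p.2
    · simpa [h] using (abs_nonneg _).trans (hC p.2)
  · ext p x
    ring

namespace SpatialCovariance

variable {d : ℕ} (Γ : SpatialCovariance d)

/-- The deterministic simple functions, endowed below with
`⟨f, g⟩_0 = ∫_0^T ∫ (f(t) ∗ g̃(t))(x) Γ(dx) dt`. -/
def SimpleDet (_Γ : SpatialCovariance d) (T : ℝ≥0) : Type := simpleFunctions d T

section

variable (T : ℝ≥0)

instance : AddCommGroup (Γ.SimpleDet T) := inferInstanceAs (AddCommGroup (simpleFunctions d T))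

instance : Module ℝ (Γ.SimpleDet T) := inferInstanceAs (Module ℝ (simpleFunctions d T))

instance : CoeFun (Γ.SimpleDet T) (fun _ => ℝ≥0 → Space d → ℝ) :=
  ⟨fun g => Subtype.val (p := fun f => f ∈ simpleFunctions d T) g⟩

/-- The inner product `⟨f, g⟩_0 = ∫_0^T ∫ (f(t) ∗ g̃(t))(x) Γ(dx) dt`. -/
@[reducible] def simpleDetCore : PreInnerProductSpace.Core ℝ (Γ.SimpleDet T) :=
  Γ.integralCore (timeMeasure T) (simpleFunctions d T) (simpleFunctions_le d T)

instance : SeminormedAddCommGroup (Γ.SimpleDet T) :=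
  @InnerProductSpace.Core.toSeminormedAddCommGroup ℝ _ _ _ _ (Γ.simpleDetCore T)

instance : InnerProductSpace ℝ (Γ.SimpleDet T) := InnerProductSpace.ofCore (Γ.simpleDetCore T)

/-- The space `P_{0,d}` of deterministic integrands: the completion of the deterministic simple
functions with respect to `‖·‖_0`. -/
abbrev P0Det : Type := UniformSpace.Completion (Γ.SimpleDet T)

/-- The space `H_T = L²([0,T]; H)`. -/
abbrev HT : Type := Lp Γ.H 2 (timeMeasure T)

end

section

variable (T : ℝ≥0) {Ω : Type*} {mΩ : MeasurableSpace Ω} (P : Measure Ω) (𝓕 : Filtration ℝ≥0 mΩ)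

/-- The simple processes, endowed below with
`⟨f, g⟩_0 = E [∫_0^T ∫ (f(t) ∗ g̃(t))(x) Γ(dx) dt]`. -/
def SimpleProc (_Γ : SpatialCovariance d) (T : ℝ≥0) {Ω : Type*} {mΩ : MeasurableSpace Ω}
    (_P : Measure Ω) (𝓕 : Filtration ℝ≥0 mΩ) : Type _ := simpleProcesses d T 𝓕

instance : AddCommGroup (Γ.SimpleProc T P 𝓕) :=
  inferInstanceAs (AddCommGroup (simpleProcesses d T 𝓕))

instance : Module ℝ (Γ.SimpleProc T P 𝓕) := inferInstanceAs (Module ℝ (simpleProcesses d T 𝓕))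

instance : CoeFun (Γ.SimpleProc T P 𝓕) (fun _ => ℝ≥0 × Ω → Space d → ℝ) :=
  ⟨fun g => Subtype.val (p := fun f => f ∈ simpleProcesses d T 𝓕) g⟩

/-- The product measure `dt ⊗ P` on `[0,T] × Ω`. -/
abbrev timeProd : Measure (ℝ≥0 × Ω) := (timeMeasure T).prod P

variable [IsProbabilityMeasure P]

/-- The inner product `⟨f, g⟩_0 = E [∫_0^T ∫ (f(t) ∗ g̃(t))(x) Γ(dx) dt]`. -/
@[reducible] def simpleProcCore : PreInnerProductSpace.Core ℝ (Γ.SimpleProc T P 𝓕) :=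
  Γ.integralCore (timeProd T P) (simpleProcesses d T 𝓕) (simpleProcesses_le d T 𝓕)

instance : SeminormedAddCommGroup (Γ.SimpleProc T P 𝓕) :=
  @InnerProductSpace.Core.toSeminormedAddCommGroup ℝ _ _ _ _ (Γ.simpleProcCore T P 𝓕)

instance : InnerProductSpace ℝ (Γ.SimpleProc T P 𝓕) :=
  InnerProductSpace.ofCore (Γ.simpleProcCore T P 𝓕)

/-- The space `P_0` of integrands: the completion of the simple processes with respect to
`‖·‖_0`. -/
abbrev P0 : Type _ := UniformSpace.Completion (Γ.SimpleProc T P 𝓕)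

/-- The (classes of) predictable processes in `L²([0,T] × Ω; H)`. -/
abbrev L2Predictable : Type _ := lpMeas Γ.H ℝ 𝓕.predictable 2 (timeProd T P)

end

end SpatialCovariance
end SpatialNoise
end

/-! Both identifications rest on one principle (`exists_completion_equiv`): a linear isometry with
dense range from a seminormed space into a complete space extends to an isometric bijection from the
completion. So simple functions must be read as `H`-valued functions without changing inner
products, and their images must be shown to be dense.

Reading. Indicators are not Schwartz functions, so they first have to be placed in `H`. The form is
a semi-inner product on all rapidly decreasing measurable functions. Mollification and cut-off
approximate such a function by test functions under a common rapidly decreasing majorant, and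
dominated convergence turns this into convergence in the seminorm (`tendsto_ofRapid`). Hence the
Schwartz functions are dense there, both completions agree, and `rapidToH` results. Applied
pointwise in time and `ω` it gives `elementaryToL2`, which carries the inner product of `‖·‖_0` to
that of `L²`.

Density. It suffices that an `f` orthogonal to the image vanishes. Orthogonality to `1_{(a,T]} 1_B
1_A` says that `⟨1_A, f⟩` integrates to zero over `(a,T] × B`. The rays, respectively the rectangles
`(a,∞) × B` with `B ∈ 𝓕 a` together with the null rectangles at time `0`, form a π-system generating
the Borel, respectively predictable, σ-algebra. So the integral vanishes over every set of that
σ-algebra (`Lp_eq_zero_of_piSystem`). Indicators are total in `H` (`eq_zero_of_inner_indicatorH`),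
so the vector integrals of `f` vanish and `f = 0`.

Uniqueness holds because inner products with Schwartz functions determine an element of `L²`
(`Lp_ext_ofSchwartz`) and simple functions are dense in the completion. The deterministic elements
are the range of the isometric, hence closed, embedding of `H_T`, in which deterministic simple
functions are dense by the first part. -/

noncomputable section

namespace SpatialNoise

namespace SpatialCovariance

variable {d : ℕ} (Γ : SpatialCovariance d)

/-! ### Rapidly decreasing functions as elements of `H` -/

/-- The rapidly decreasing functions, endowed below with the inner product given by `Γ`. -/
def RapidPre (_Γ : SpatialCovariance d) : Type := rapid d

instance : AddCommGroup Γ.RapidPre := inferInstanceAs (AddCommGroup (rapid d))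

instance : Module ℝ Γ.RapidPre := inferInstanceAs (Module ℝ (rapid d))

/-- The inner product given by `Γ` on rapidly decreasing functions. -/
@[reducible] def rapidCore : PreInnerProductSpace.Core ℝ Γ.RapidPre where
  inner f g := Γ.form f.1 g.1
  conj_inner_symm f g := Γ.form_symm g.2 f.2
  re_inner_nonneg f := (Γ.form_symm_and_nonneg f.2 f.2).2
  add_left f g h := Γ.form_add_left f.2 g.2 h.2
  smul_left f g c := Γ.form_smul_left c f.1 g.1

instance : SeminormedAddCommGroup Γ.RapidPre :=
  @InnerProductSpace.Core.toSeminormedAddCommGroup ℝ _ _ _ _ Γ.rapidCore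

instance : InnerProductSpace ℝ Γ.RapidPre := InnerProductSpace.ofCore Γ.rapidCore

/-- A rapidly decreasing function as an element of the seminormed space `RapidPre`. -/
def ofRapid : rapid d →ₗ[ℝ] Γ.RapidPre := LinearMap.id

lemma inner_ofRapid (f g : rapid d) :
    inner ℝ (Γ.ofRapid f) (Γ.ofRapid g) = Γ.form f.1 g.1 := rfl

lemma norm_ofRapid_sq (f : rapid d) : ‖Γ.ofRapid f‖ ^ 2 = Γ.form f.1 f.1 := by
  rw [← real_inner_self_eq_norm_sq, inner_ofRapid]

/-- Pointwise dominated convergence implies convergence in the seminorm given by `Γ`. -/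
lemma tendsto_ofRapid {m n : ℕ} (hm : Integrable (fun x : Space d => ((1 + ‖x‖) ^ m)⁻¹))
    (hn : Integrable (fun x : Space d => ((1 + ‖x‖) ^ n)⁻¹) Γ.measure)
    {F : ℕ → rapid d} {f : rapid d} {C : ℝ}
    (hF : ∀ i x, |(F i).1 x| ≤ C * ((1 + ‖x‖) ^ (m + n))⁻¹)
    (hFf : ∀ᵐ x, Tendsto (fun i => (F i).1 x) atTop (𝓝 (f.1 x))) :
    Tendsto (fun i => Γ.ofRapid (F i)) atTop (𝓝 (Γ.ofRapid f)) := by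
  obtain ⟨D, hD⟩ := f.2.2 (m + n)
  have hb : ∀ i x, |(F i - f).1 x| ≤ (C + D) * ((1 + ‖x‖) ^ (m + n))⁻¹ := fun i x => by
    have h := abs_sub ((F i).1 x) (f.1 x)
    change |(F i).1 x - f.1 x| ≤ _
    rw [add_mul]
    linarith [hF i x, hD x]
  -- Convergence Lebesgue-a.e. suffices even when `Γ` is singular: the form sees its arguments only
  -- through a Lebesgue integral in `y`, for each fixed `x`.
  have hl : ∀ᵐ x, Tendsto (fun i => (F i - f).1 x) atTop (𝓝 ((0 : Space d → ℝ) x)) := by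
    filter_upwards [hFf] with x hx
    simpa using hx.sub_const (f.1 x)
  have h := Γ.tendsto_form hm hn (fun i => (F i - f).2.1) (fun i => (F i - f).2.1) hb hb hl hl
  have h0 : Γ.form 0 0 = 0 := by simpa using Γ.form_smul_left 0 0 0
  rw [h0] at h
  rw [tendsto_iff_norm_sub_tendsto_zero]
  have h1 : Tendsto (fun i => ‖Γ.ofRapid (F i) - Γ.ofRapid f‖ ^ 2) atTop (𝓝 0) := by
    refine h.congr fun i => ?_
    rw [← map_sub, norm_ofRapid_sq]
  simpa using h1.sqrt

/-- Schwartz functions as rapidly decreasing functions. -/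
def schwartzToRapid : Γ.SchwartzPre →ₗ[ℝ] rapid d where
  toFun φ := ⟨φ.toSchwartz, schwartz_mem_rapid φ.toSchwartz⟩
  map_add' _ _ := rfl
  map_smul' _ _ := rfl

/-- The map from the Schwartz functions to the completion of the rapidly decreasing functions. -/
def schwartzToCompletion : Γ.SchwartzPre →ₗ[ℝ] UniformSpace.Completion Γ.RapidPre :=
  (UniformSpace.Completion.toComplₗᵢ (𝕜 := ℝ)).toLinearMap ∘ₗ Γ.ofRapid ∘ₗ Γ.schwartzToRapid

lemma norm_schwartzToCompletion (φ : Γ.SchwartzPre) : ‖Γ.schwartzToCompletion φ‖ = ‖φ‖ := by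
  change ‖((Γ.ofRapid (Γ.schwartzToRapid φ) : Γ.RapidPre) :
    UniformSpace.Completion Γ.RapidPre)‖ = _
  rw [UniformSpace.Completion.norm_coe, ← sq_eq_sq₀ (norm_nonneg _) (norm_nonneg _),
    norm_ofRapid_sq, ← real_inner_self_eq_norm_sq]
  rfl

/-- The mollified and truncated functions of `exists_approx` are Schwartz and share one majorant of
order `m + n`, the order that `tendsto_ofRapid` requires. -/
lemma ofRapid_mem_closure (f : rapid d) :
    Γ.ofRapid f ∈ closure (Set.range fun φ => Γ.ofRapid (Γ.schwartzToRapid φ)) := by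
  obtain ⟨m, n, hm, hn⟩ := Γ.exists_weights
  obtain ⟨F, C, hF, hFc, hFb, hFl⟩ := exists_approx f.2 (m + n)
  refine mem_closure_of_tendsto (Γ.tendsto_ofRapid hm hn
    (F := fun i => ⟨F i, test_mem_rapid (hF i) (hFc i)⟩) hFb hFl) (Eventually.of_forall fun i => ?_)
  exact ⟨(show Γ.SchwartzPre from (hFc i).toSchwartzMap (hF i)), rfl⟩

lemma denseRange_schwartzToCompletion : DenseRange Γ.schwartzToCompletion := by
  have h : DenseRange fun φ => Γ.ofRapid (Γ.schwartzToRapid φ) := Γ.ofRapid_mem_closure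
  exact UniformSpace.Completion.denseRange_coe.comp h (UniformSpace.Completion.continuous_coe _)

/-- The completion of the Schwartz functions is the completion of the rapidly decreasing
functions. -/
def completionEquiv : Γ.H ≃ₗᵢ[ℝ] UniformSpace.Completion Γ.RapidPre :=
  (LinearEquiv.refl ℝ Γ.SchwartzPre).extendOfIsometry
    (UniformSpace.Completion.toComplₗᵢ (𝕜 := ℝ)).toLinearMap Γ.schwartzToCompletion
    UniformSpace.Completion.denseRange_coe Γ.denseRange_schwartzToCompletion
    fun φ => (Γ.norm_schwartzToCompletion φ).trans (UniformSpace.Completion.norm_coe φ).symm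

/-- A rapidly decreasing function as an element of `H`. -/
def rapidToH : rapid d →ₗ[ℝ] Γ.H :=
  Γ.completionEquiv.symm.toLinearEquiv.toLinearMap ∘ₗ
    (UniformSpace.Completion.toComplₗᵢ (𝕜 := ℝ)).toLinearMap ∘ₗ Γ.ofRapid

lemma inner_rapidToH (f g : rapid d) :
    inner ℝ (Γ.rapidToH f) (Γ.rapidToH g) = Γ.form f.1 g.1 := by
  change inner ℝ (Γ.completionEquiv.symm _) (Γ.completionEquiv.symm _) = _
  rw [LinearIsometryEquiv.inner_map_map]
  exact (UniformSpace.Completion.inner_coe _ _).trans (Γ.inner_ofRapid f g)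

/-- Consistency of the two embeddings into `H`; this allows inner products of indicators with
Schwartz elements to be computed by the form. -/
lemma rapidToH_schwartz (φ : 𝓢(Space d, ℝ)) :
    Γ.rapidToH ⟨φ, schwartz_mem_rapid φ⟩ = Γ.ofSchwartz φ := by
  change Γ.completionEquiv.symm _ = _
  rw [LinearIsometryEquiv.symm_apply_eq]
  exact (LinearEquiv.extendOfIsometry_eq (LinearEquiv.refl ℝ Γ.SchwartzPre)
    (UniformSpace.Completion.toComplₗᵢ (𝕜 := ℝ)).toLinearMap Γ.schwartzToCompletion
    UniformSpace.Completion.denseRange_coe Γ.denseRange_schwartzToCompletion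
    (fun φ => (Γ.norm_schwartzToCompletion φ).trans (UniformSpace.Completion.norm_coe φ).symm)
    φ).symm

lemma continuous_of_ofRapid :
    Continuous fun f : Γ.RapidPre => Γ.completionEquiv.symm (f : UniformSpace.Completion Γ.RapidPre) :=
  Γ.completionEquiv.symm.continuous.comp (UniformSpace.Completion.continuous_coe _)

/-! ### Total subsets of `H` -/

lemma eq_zero_of_inner_ofSchwartz {h : Γ.H}
    (hh : ∀ φ : 𝓢(Space d, ℝ), inner ℝ (Γ.ofSchwartz φ) h = 0) : h = 0 := by
  have key : ∀ c : Γ.H, inner ℝ c h = 0 := by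
    intro c
    induction c using UniformSpace.Completion.induction_on with
    | hp => exact isClosed_eq (by fun_prop) continuous_const
    | ih φ => exact hh φ.toSchwartz
  simpa using key h

/-- The indicator of a bounded Borel set as an element of `H`. -/
def indicatorH {A : Set (Space d)} (hA : MeasurableSet A) (hb : Bornology.IsBounded A) : Γ.H :=
  Γ.rapidToH ⟨A.indicator fun _ => 1, indicator_mem_rapid hA hb⟩

/-- Only bounded sets are admitted, so the standard simple approximation is cut off to the ball of
radius `i`. The bound `2 * |f x|` is the one satisfied by `SimpleFunc.approxOn` based at `0`; it
keeps the sequence under a rapidly decreasing majorant when `f` is rapidly decreasing. -/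
lemma exists_simple_approx {f : Space d → ℝ} (hf : Measurable f) (i : ℕ) :
    ∃ g : rapid d, (∀ x, |g.1 x| ≤ 2 * |f x|) ∧
      (∀ x, ‖x‖ ≤ i → g.1 x = SimpleFunc.approxOn f hf Set.univ 0 trivial i x) ∧
      g ∈ Submodule.span ℝ {g : rapid d | ∃ (A : Set (Space d)) (hA : MeasurableSet A)
        (hb : Bornology.IsBounded A), g = ⟨A.indicator fun _ => 1, indicator_mem_rapid hA hb⟩} := by
  set s := SimpleFunc.approxOn f hf Set.univ 0 trivial i
  set B : Set (Space d) := Metric.closedBall 0 i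
  have hB : ∀ r : ℝ, Bornology.IsBounded (s ⁻¹' {r} ∩ B) := fun r =>
    Metric.isBounded_closedBall.subset Set.inter_subset_right
  have hBm : ∀ r : ℝ, MeasurableSet (s ⁻¹' {r} ∩ B) := fun r =>
    (s.measurableSet_fiber r).inter Metric.isClosed_closedBall.measurableSet
  have hval : ∀ x, (∑ r ∈ s.range, r • (⟨(s ⁻¹' {r} ∩ B).indicator fun _ => 1,
      indicator_mem_rapid (hBm r) (hB r)⟩ : rapid d)).1 x = B.indicator s x := by
    intro x
    rw [AddSubmonoidClass.coe_finsetSum, Finset.sum_apply, Finset.sum_eq_single (s x)]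
    · by_cases hx : x ∈ B <;> simp [Set.indicator, hx]
    · intro r _ hr
      simp [Set.indicator, Ne.symm hr]
    · intro h
      exact absurd (s.mem_range_self x) h
  refine ⟨∑ r ∈ s.range, r • ⟨(s ⁻¹' {r} ∩ B).indicator fun _ => 1,
    indicator_mem_rapid (hBm r) (hB r)⟩, ?_, ?_, ?_⟩
  · intro x
    rw [hval]
    by_cases hx : x ∈ B
    · rw [Set.indicator_of_mem hx]
      have := SimpleFunc.norm_approxOn_zero_le hf (s := Set.univ) trivial x i
      rw [Real.norm_eq_abs, Real.norm_eq_abs] at this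
      linarith
    · rw [Set.indicator_of_notMem hx]
      simp
  · intro x hx
    rw [hval, Set.indicator_of_mem]
    simpa [B] using hx
  · exact Submodule.sum_mem _ fun r _ =>
      Submodule.smul_mem _ r (Submodule.subset_span ⟨_, hBm r, hB r, rfl⟩)

/-- The indicators of bounded Borel sets are total in `H`. -/
lemma eq_zero_of_inner_indicatorH {h : Γ.H}
    (hh : ∀ (A : Set (Space d)) (hA : MeasurableSet A) (hb : Bornology.IsBounded A),
      inner ℝ (Γ.indicatorH hA hb) h = 0) : h = 0 := by
  have hspan : ∀ g ∈ Submodule.span ℝ {g : rapid d | ∃ (A : Set (Space d)) (hA : MeasurableSet A)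
        (hb : Bornology.IsBounded A), g = ⟨A.indicator fun _ => 1, indicator_mem_rapid hA hb⟩},
      inner ℝ (Γ.rapidToH g) h = 0 := by
    intro g hg
    induction hg using Submodule.span_induction with
    | mem g hg =>
      obtain ⟨A, hA, hb, rfl⟩ := hg
      exact hh A hA hb
    | zero => simp
    | add f g _ _ hf hg => rw [map_add, inner_add_left, hf, hg, add_zero]
    | smul c f _ hf => rw [map_smul, inner_smul_left, hf, mul_zero]
  refine Γ.eq_zero_of_inner_ofSchwartz fun φ => ?_
  rw [← Γ.rapidToH_schwartz]
  set f : rapid d := ⟨φ, schwartz_mem_rapid φ⟩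
  obtain ⟨m, n, hm, hn⟩ := Γ.exists_weights
  obtain ⟨C, hC⟩ := f.2.2 (m + n)
  choose g hg1 hg2 hg3 using exists_simple_approx f.2.1
  have hlim : Tendsto (fun i => Γ.ofRapid (g i)) atTop (𝓝 (Γ.ofRapid f)) := by
    refine Γ.tendsto_ofRapid hm hn (C := 2 * C) (fun i x => ?_) (Eventually.of_forall fun x => ?_)
    · linarith [hg1 i x, hC x, mul_assoc 2 C ((1 + ‖x‖) ^ (m + n))⁻¹]
    · refine (SimpleFunc.tendsto_approxOn f.2.1 (s := Set.univ) (y₀ := 0)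
        trivial (x := x) (by simp)).congr' ?_
      -- From the first index exceeding `‖x‖` on, the cut-off is invisible at `x`.
      obtain ⟨N, hN⟩ := exists_nat_ge ‖x‖
      filter_upwards [eventually_ge_atTop N] with i hi
      exact (hg2 i x (hN.trans (by exact_mod_cast hi))).symm
  have h2 : Tendsto (fun i => inner ℝ (Γ.rapidToH (g i)) h) atTop
      (𝓝 (inner ℝ (Γ.rapidToH f) h)) :=
    ((Γ.continuous_of_ofRapid.tendsto _).comp hlim).inner tendsto_const_nhds
  refine tendsto_nhds_unique h2 ?_
  simp only [hspan _ (hg3 _)]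
  exact tendsto_const_nhds

end SpatialCovariance

end SpatialNoise

end

noncomputable section

namespace SpatialNoise

namespace SpatialCovariance

variable {d : ℕ} (Γ : SpatialCovariance d)

/-! ### Elementary functions as square-integrable functions with values in `H` -/

section

variable {Y : Type*} {m : MeasurableSpace Y} [MeasurableSpace Y]

/-- An elementary function as a function with values in `H`. -/
def elementaryToH (g : elementary Y d) (y : Y) : Γ.H :=
  Γ.rapidToH ⟨g.1 y, elementary_rapid g.2 y⟩

lemma elementaryToH_add (f g : elementary Y d) :
    Γ.elementaryToH (f + g) = Γ.elementaryToH f + Γ.elementaryToH g := by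
  ext1 y
  exact map_add Γ.rapidToH ⟨f.1 y, elementary_rapid f.2 y⟩ ⟨g.1 y, elementary_rapid g.2 y⟩

lemma elementaryToH_smul (c : ℝ) (f : elementary Y d) :
    Γ.elementaryToH (c • f) = c • Γ.elementaryToH f := by
  ext1 y
  exact map_smul Γ.rapidToH c ⟨f.1 y, elementary_rapid f.2 y⟩

lemma elementaryToH_zero : Γ.elementaryToH (0 : elementary Y d) = 0 := by
  simpa using Γ.elementaryToH_smul 0 (0 : elementary Y d)

lemma inner_elementaryToH (f g : elementary Y d) (y : Y) :
    inner ℝ (Γ.elementaryToH f y) (Γ.elementaryToH g y) = Γ.form (f.1 y) (g.1 y) :=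
  Γ.inner_rapidToH _ _

lemma inner_elementaryToH_ofSchwartz (g : elementary Y d) (φ : 𝓢(Space d, ℝ)) (y : Y) :
    inner ℝ (Γ.elementaryToH g y) (Γ.ofSchwartz φ) = Γ.form (g.1 y) φ := by
  rw [← rapidToH_schwartz]
  exact Γ.inner_rapidToH _ _

lemma elementaryToH_apply_eq (g : elementary Y d) {u : Y → ℝ} {A : Set (Space d)}
    (hA : MeasurableSet A) (hb : Bornology.IsBounded A)
    (hg : g.1 = fun y x => u y * A.indicator (fun _ => (1 : ℝ)) x) (y : Y) :
    Γ.elementaryToH g y = u y • Γ.indicatorH hA hb := by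
  unfold indicatorH
  rw [← map_smul]
  refine congrArg Γ.rapidToH (Subtype.ext ?_)
  simp only [hg]
  rfl

/-- A subspace of elementary functions generated by products `u ⊗ 1_A` with `m`-measurable `u`
consists of functions that are `m`-measurable as functions with values in `H`. -/
lemma stronglyMeasurable_elementaryToH {S : Set (Y → Space d → ℝ)}
    (hS : ∀ g ∈ S, ∃ (u : Y → ℝ) (A : Set (Space d)), Measurable[m] u ∧ MeasurableSet A ∧
      Bornology.IsBounded A ∧ g = fun y x => u y * A.indicator (fun _ => (1 : ℝ)) x)
    (hSe : Submodule.span ℝ S ≤ elementary Y d) {g : Y → Space d → ℝ}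
    (hg : g ∈ Submodule.span ℝ S) :
    StronglyMeasurable[m] (Γ.elementaryToH ⟨g, hSe hg⟩) := by
  induction hg using Submodule.span_induction with
  | mem g hg =>
    obtain ⟨u, A, hu, hA, hb, h⟩ := hS g hg
    rw [funext (Γ.elementaryToH_apply_eq ⟨g, hSe (Submodule.subset_span hg)⟩ hA hb h)]
    exact hu.stronglyMeasurable.smul_const _
  | zero =>
    rw [show (⟨0, _⟩ : elementary Y d) = 0 from rfl, elementaryToH_zero]
    exact stronglyMeasurable_zero
  | add f g hf' hg' hf hg =>
    rw [show (⟨f + g, _⟩ : elementary Y d) = ⟨f, hSe hf'⟩ + ⟨g, hSe hg'⟩ from rfl,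
      elementaryToH_add]
    exact hf.add hg
  | smul c f hf' hf =>
    rw [show (⟨c • f, _⟩ : elementary Y d) = c • ⟨f, hSe hf'⟩ from rfl, elementaryToH_smul]
    exact hf.const_smul c

lemma memLp_elementaryToH (ν : Measure Y) [IsFiniteMeasure ν] (g : elementary Y d) :
    MemLp (Γ.elementaryToH g) 2 ν := by
  have hm : StronglyMeasurable (Γ.elementaryToH g) := by
    refine Γ.stronglyMeasurable_elementaryToH ?_ le_rfl g.2
    rintro g ⟨u, A, hu, -, hA, hb, rfl⟩
    exact ⟨u, A, hu, hA, hb, rfl⟩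
  rw [memLp_two_iff_integrable_sq_norm hm.aestronglyMeasurable]
  refine (Γ.elementary_integrable ν g.2 g.2).congr (Eventually.of_forall fun y => ?_)
  simp only
  rw [← real_inner_self_eq_norm_sq, inner_elementaryToH]

/-- Elementary functions as elements of `L²(Y; H)`. -/
def elementaryToL2 (ν : Measure Y) [IsFiniteMeasure ν] : elementary Y d →ₗ[ℝ] Lp Γ.H 2 ν where
  toFun g := (Γ.memLp_elementaryToH ν g).toLp
  map_add' f g := by
    rw [← MemLp.toLp_add]
    exact MemLp.toLp_congr _ _ (by rw [elementaryToH_add])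
  map_smul' c g := by
    rw [RingHom.id_apply, ← MemLp.toLp_const_smul]
    exact MemLp.toLp_congr _ _ (by rw [elementaryToH_smul])

lemma coeFn_elementaryToL2 (ν : Measure Y) [IsFiniteMeasure ν] (g : elementary Y d) :
    Γ.elementaryToL2 ν g =ᵐ[ν] Γ.elementaryToH g :=
  (Γ.memLp_elementaryToH ν g).coeFn_toLp

lemma inner_elementaryToL2 (ν : Measure Y) [IsFiniteMeasure ν] (f g : elementary Y d) :
    inner ℝ (Γ.elementaryToL2 ν f) (Γ.elementaryToL2 ν g) = ∫ y, Γ.form (f.1 y) (g.1 y) ∂ν := by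
  rw [L2.inner_def]
  refine integral_congr_ae ?_
  filter_upwards [Γ.coeFn_elementaryToL2 ν f, Γ.coeFn_elementaryToL2 ν g] with y hf hg
  rw [hf, hg, inner_elementaryToH]

lemma inner_elementaryToL2_ofSchwartz (ν : Measure Y) [IsFiniteMeasure ν] (g : elementary Y d)
    (φ : 𝓢(Space d, ℝ)) :
    ∀ᵐ y ∂ν, inner ℝ (Γ.elementaryToL2 ν g y) (Γ.ofSchwartz φ) = Γ.form (g.1 y) φ := by
  filter_upwards [Γ.coeFn_elementaryToL2 ν g] with y hy
  rw [hy, inner_elementaryToH_ofSchwartz]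

end

/-! ### Functions orthogonal to a total set on a generating `π`-system -/

section

variable {Y : Type*} {m m0 : MeasurableSpace Y} {ν : Measure Y} [IsFiniteMeasure ν]

lemma integrable_inner_Lp (f : Lp Γ.H 2 ν) (c : Γ.H) : Integrable (fun y => inner ℝ c (f y)) ν :=
  ((Lp.memLp f).integrable one_le_two).const_inner c

/-- An `m`-measurable `f ∈ L²(ν; H)` vanishes if `∫_s ⟨c, f⟩ dν = 0` for all `m`-measurable `s` and
all `c` in a total set. -/
lemma Lp_eq_zero_of_setIntegral_inner (hm : m ≤ m0) (f : Lp Γ.H 2 ν)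
    (hf : AEStronglyMeasurable[m] f ν) {D : Set Γ.H}
    (hD : ∀ h : Γ.H, (∀ c ∈ D, inner ℝ c h = 0) → h = 0)
    (h : ∀ c ∈ D, ∀ s, MeasurableSet[m] s → ∫ y in s, inner ℝ c (f y) ∂ν = 0) : f = 0 := by
  have hfi : Integrable f ν := (Lp.memLp f).integrable one_le_two
  rw [Lp.eq_zero_iff_ae_eq_zero]
  -- The total set tests the vector integral of `f` over `s`, not the values of `f`, so `D` need not
  -- be countable.
  refine Lp.ae_eq_zero_of_forall_setIntegral_eq_zero' ℝ hm f two_ne_zero ENNReal.ofNat_ne_top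
    (fun s _ _ => hfi.integrableOn) (fun s hs _ => hD _ fun c hc => ?_) hf
  rw [← integral_inner hfi.integrableOn]
  exact h c hc s hs

/-- It suffices to consider a `π`-system that generates `m`, and the whole space. -/
lemma Lp_eq_zero_of_piSystem (hm : m ≤ m0) (f : Lp Γ.H 2 ν)
    (hf : AEStronglyMeasurable[m] f ν) {D : Set Γ.H}
    (hD : ∀ h : Γ.H, (∀ c ∈ D, inner ℝ c h = 0) → h = 0) {C : Set (Set Y)}
    (hC : m = MeasurableSpace.generateFrom C) (hπ : IsPiSystem C)
    (huniv : ∀ c ∈ D, ∫ y, inner ℝ c (f y) ∂ν = 0)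
    (h : ∀ c ∈ D, ∀ s ∈ C, ∫ y in s, inner ℝ c (f y) ∂ν = 0) : f = 0 := by
  refine Γ.Lp_eq_zero_of_setIntegral_inner hm f hf hD fun c hc s hs => ?_
  have hi := Γ.integrable_inner_Lp f c
  induction s, hs using MeasurableSpace.induction_on_inter hC hπ with
  | empty => simp
  | basic s hs => exact h c hc s hs
  | compl s hs ih =>
    have := integral_add_compl (hm s hs) hi
    rw [ih, huniv c hc, zero_add] at this
    exact this
  | iUnion s hd hs ih =>
    rw [integral_iUnion (fun i => hm _ (hs i)) hd hi.integrableOn]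
    simp [ih]

/-- Elements of `L²(ν; H)` are determined by the inner products with the Schwartz functions. -/
lemma Lp_ext_ofSchwartz {f g : Lp Γ.H 2 ν} (h : ∀ φ : 𝓢(Space d, ℝ),
    ∀ᵐ y ∂ν, inner ℝ (f y) (Γ.ofSchwartz φ) = inner ℝ (g y) (Γ.ofSchwartz φ)) : f = g := by
  rw [← sub_eq_zero]
  -- The exceptional null set depends on `φ`; passing to integrals over sets avoids having to
  -- intersect uncountably many of them.
  refine Γ.Lp_eq_zero_of_setIntegral_inner le_rfl _ (Lp.aestronglyMeasurable _)
    (D := Set.range Γ.ofSchwartz)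
    (fun k hk => Γ.eq_zero_of_inner_ofSchwartz fun φ => hk _ ⟨φ, rfl⟩) ?_
  rintro _ ⟨φ, rfl⟩ s -
  refine integral_eq_zero_of_ae (ae_restrict_of_ae ?_)
  filter_upwards [h φ, Lp.coeFn_sub f g] with y hy h2
  rw [h2, Pi.sub_apply, inner_sub_right, real_inner_comm, hy, real_inner_comm, sub_self]
  rfl

end

/-! ### The time axis -/

/-- Time `0` is discarded because the intervals `(a,b]` never contain it; it is a Lebesgue null
point. -/
lemma ae_timeMeasure (T : ℝ≥0) : ∀ᵐ t ∂timeMeasure T, t ∈ Set.Ioc 0 T := by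
  unfold timeMeasure
  refine (ae_map_iff (by fun_prop) measurableSet_Ioc).2 ?_
  have h0 : ∀ᵐ t ∂(volume : Measure ℝ), t ≠ 0 := by simp [ae_iff]
  filter_upwards [ae_restrict_mem measurableSet_Icc, ae_restrict_of_ae h0] with t ht ht0
  refine ⟨?_, ?_⟩
  · rw [Real.toNNReal_pos]
    exact lt_of_le_of_ne ht.1 ht0.symm
  · rw [Real.toNNReal_le_iff_le_coe]
    exact ht.2

lemma ae_timeProd (T : ℝ≥0) {Ω : Type*} {mΩ : MeasurableSpace Ω} (P : Measure Ω)
    [IsProbabilityMeasure P] : ∀ᵐ p ∂timeProd T P, p.1 ∈ Set.Ioc 0 T :=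
  Measure.quasiMeasurePreserving_fst.ae (ae_timeMeasure T)

end SpatialCovariance

end SpatialNoise

end

noncomputable section

namespace SpatialNoise

namespace SpatialCovariance

variable {d : ℕ} (Γ : SpatialCovariance d)

/-! ### Dense isometries and completions -/

lemma linearMap_denseRange_of_orthogonal {E F : Type*} [AddCommGroup E] [Module ℝ E]
    [NormedAddCommGroup F] [InnerProductSpace ℝ F] [CompleteSpace F] (J : E →ₗ[ℝ] F)
    (h : ∀ f : F, (∀ g, inner ℝ (J g) f = 0) → f = 0) : DenseRange J := by
  rw [DenseRange, ← LinearMap.coe_range, Submodule.dense_iff_topologicalClosure_eq_top,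
    Submodule.topologicalClosure_eq_top_iff, Submodule.eq_bot_iff]
  intro f hf
  exact h f fun g => (Submodule.mem_orthogonal _ _).1 hf _ ⟨g, rfl⟩

/-- An isometric linear map with dense range extends to an isometry of the completion onto the
target. -/
lemma exists_completion_equiv {E F : Type*} [SeminormedAddCommGroup E] [NormedSpace ℝ E]
    [NormedAddCommGroup F] [NormedSpace ℝ F] [CompleteSpace F] (J : E →ₗ[ℝ] F)
    (hJ : ∀ g, ‖J g‖ = ‖g‖) (hd : DenseRange J) :
    ∃ e : UniformSpace.Completion E ≃ₗᵢ[ℝ] F, ∀ g : E, e (g : UniformSpace.Completion E) = J g := by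
  have hn : ∀ g : E, ‖J (LinearEquiv.refl ℝ E g)‖ =
      ‖(UniformSpace.Completion.toComplₗᵢ (𝕜 := ℝ) : E →ₗᵢ[ℝ] _).toLinearMap g‖ := fun g =>
    (hJ g).trans (UniformSpace.Completion.norm_coe g).symm
  exact ⟨(LinearEquiv.refl ℝ E).extendOfIsometry
    (UniformSpace.Completion.toComplₗᵢ (𝕜 := ℝ)).toLinearMap J
    UniformSpace.Completion.denseRange_coe hd hn, fun g =>
    LinearEquiv.extendOfIsometry_eq _ _ J UniformSpace.Completion.denseRange_coe hd hn g⟩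

lemma completion_equiv_ext {E F : Type*} [SeminormedAddCommGroup E] [NormedSpace ℝ E]
    [NormedAddCommGroup F] [NormedSpace ℝ F] {e₁ e₂ : UniformSpace.Completion E ≃ₗᵢ[ℝ] F}
    (h : ∀ g : E, e₁ (g : UniformSpace.Completion E) = e₂ (g : UniformSpace.Completion E)) :
    e₁ = e₂ := by
  ext x
  induction x using UniformSpace.Completion.induction_on with
  | hp => exact isClosed_eq e₁.continuous e₂.continuous
  | ih g => exact h g

/-- The set of indicators of bounded Borel sets in `H`. -/
def indicatorSet : Set Γ.H :=
  {c | ∃ (A : Set (Space d)) (hA : MeasurableSet A) (hb : Bornology.IsBounded A),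
    c = Γ.indicatorH hA hb}

lemma eq_zero_of_inner_indicatorSet (h : Γ.H) (hh : ∀ c ∈ Γ.indicatorSet, inner ℝ c h = 0) :
    h = 0 :=
  Γ.eq_zero_of_inner_indicatorH fun _ hA hb => hh _ ⟨_, hA, hb, rfl⟩

/-- The inner product in `L²` with an elementary function `1_S ⊗ 1_A`. -/
lemma inner_elementaryToL2_indicator {Y : Type*} [MeasurableSpace Y] {ν : Measure Y}
    [IsFiniteMeasure ν] (f : Lp Γ.H 2 ν) (g : elementary Y d) {S : Set Y} (hS : MeasurableSet S)
    {A : Set (Space d)} (hA : MeasurableSet A) (hb : Bornology.IsBounded A)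
    (hg : g.1 = fun y x => S.indicator (fun _ => (1 : ℝ)) y * A.indicator (fun _ => (1 : ℝ)) x) :
    inner ℝ (Γ.elementaryToL2 ν g) f = ∫ y in S, inner ℝ (Γ.indicatorH hA hb) (f y) ∂ν := by
  rw [L2.inner_def, ← integral_indicator hS]
  refine integral_congr_ae ?_
  filter_upwards [Γ.coeFn_elementaryToL2 ν g] with y hy
  rw [hy, Γ.elementaryToH_apply_eq g hA hb hg]
  by_cases h : y ∈ S <;> simp [h]

/-! ### Deterministic integrands -/

section

variable (T : ℝ≥0)

/-- Deterministic simple functions are elementary. -/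
def simpleDetToElementary : Γ.SimpleDet T →ₗ[ℝ] elementary ℝ≥0 d where
  toFun g := ⟨g.1, simpleFunctions_le d T g.2⟩
  map_add' _ _ := rfl
  map_smul' _ _ := rfl

/-- The deterministic simple functions in `H_T`. -/
def simpleDetToHT : Γ.SimpleDet T →ₗ[ℝ] Γ.HT T :=
  Γ.elementaryToL2 (timeMeasure T) ∘ₗ Γ.simpleDetToElementary T

lemma simpleDetToHT_apply (g : Γ.SimpleDet T) :
    Γ.simpleDetToHT T g = Γ.elementaryToL2 (timeMeasure T) (Γ.simpleDetToElementary T g) := rfl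

lemma norm_simpleDetToHT (g : Γ.SimpleDet T) : ‖Γ.simpleDetToHT T g‖ = ‖g‖ := by
  rw [← sq_eq_sq₀ (norm_nonneg _) (norm_nonneg _), ← real_inner_self_eq_norm_sq,
    ← real_inner_self_eq_norm_sq, simpleDetToHT_apply, inner_elementaryToL2]
  rfl

lemma denseRange_simpleDetToHT : DenseRange (Γ.simpleDetToHT T) := by
  refine linearMap_denseRange_of_orthogonal _ fun f hf => ?_
  have key : ∀ c ∈ Γ.indicatorSet, ∀ a : ℝ≥0,
      ∫ t in Set.Ioi a, inner ℝ c (f t) ∂timeMeasure T = 0 := by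
    rintro _ ⟨A, hA, hb, rfl⟩ a
    -- Rays generate the Borel sets, while simple functions live on intervals inside `[0,T]`; modulo
    -- null sets a ray is `(a,T]`, which is empty unless `a < T`.
    have hae : (Set.Ioi a : Set ℝ≥0) =ᵐ[timeMeasure T] Set.Ioc a T := by
      filter_upwards [ae_timeMeasure T] with t ht
      exact propext ⟨fun h => ⟨h, ht.2⟩, fun h => h.1⟩
    rw [setIntegral_congr_set hae]
    by_cases haT : a < T
    · have := hf (show Γ.SimpleDet T from ⟨_, Submodule.subset_span
        ⟨a, T, A, haT, le_rfl, hA, hb, rfl⟩⟩)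
      rwa [simpleDetToHT, LinearMap.comp_apply,
        Γ.inner_elementaryToL2_indicator f _ measurableSet_Ioc hA hb rfl] at this
    · rw [Set.Ioc_eq_empty haT]
      simp
  refine Γ.Lp_eq_zero_of_piSystem le_rfl f (Lp.aestronglyMeasurable f)
    Γ.eq_zero_of_inner_indicatorSet (C := Set.range Set.Ioi)
    (BorelSpace.measurable_eq.trans (borel_eq_generateFrom_Ioi _)) isPiSystem_Ioi
    (fun c hc => ?_) ?_
  -- The whole axis is not an open ray, but agrees a.e. with the ray from `0`.
  · rw [← key c hc 0, ← setIntegral_univ]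
    refine setIntegral_congr_set ?_
    filter_upwards [ae_timeMeasure T] with t ht
    exact propext ⟨fun _ => ht.1, fun _ => trivial⟩
  · rintro c hc _ ⟨a, rfl⟩
    exact key c hc a

end

/-! ### Random integrands -/

section

variable (T : ℝ≥0) {Ω : Type*} {mΩ : MeasurableSpace Ω} (P : Measure Ω) [IsProbabilityMeasure P]
  (𝓕 : Filtration ℝ≥0 mΩ)

lemma predictable_le :
    𝓕.predictable ≤ (inferInstance : MeasurableSpace (ℝ≥0 × Ω)) :=
  measurableSpace_le_predictable_of_measurableSet
    (fun _ hA => (measurableSet_singleton _).prod (𝓕.le _ _ hA))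
    (fun _ _ hA => measurableSet_Ioi.prod (𝓕.le _ _ hA))

/-- The factor `p ↦ X p.2` alone need not be predictable, since `X` is known only from time `a` on;
hence preimages are computed directly instead of multiplying measurable functions. -/
lemma measurable_predictable_mul {a b : ℝ≥0} {X : Ω → ℝ} (hX : Measurable[𝓕 a] X) :
    Measurable[𝓕.predictable]
      fun p : ℝ≥0 × Ω => (Set.Ioc a b).indicator (fun _ => (1 : ℝ)) p.1 * X p.2 := by
  have h : (fun p : ℝ≥0 × Ω => (Set.Ioc a b).indicator (fun _ => (1 : ℝ)) p.1 * X p.2) =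
      (Set.Ioc a b ×ˢ Set.univ).indicator fun p => X p.2 := by
    ext p
    by_cases hp : p.1 ∈ Set.Ioc a b
    · rw [Set.indicator_of_mem hp, Set.indicator_of_mem (by simpa using hp), one_mul]
    · rw [Set.indicator_of_notMem hp, Set.indicator_of_notMem (by simpa using hp), zero_mul]
  rw [h]
  have hR : MeasurableSet[𝓕.predictable] (Set.Ioc a b ×ˢ (Set.univ : Set Ω)) :=
    measurableSet_predictable_Ioc_prod a b MeasurableSet.univ
  intro B hB
  rw [Set.indicator_preimage, Set.ite]
  -- Within the strip the preimage is the rectangle `(a,b] × X⁻¹(B)` with `X⁻¹(B) ∈ 𝓕 a`; off the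
  -- strip the function is constantly `0`.
  refine MeasurableSet.union ?_ (MeasurableSet.diff (measurable_const hB) hR)
  have h2 : (fun p : ℝ≥0 × Ω => X p.2) ⁻¹' B ∩ Set.Ioc a b ×ˢ Set.univ =
      Set.Ioc a b ×ˢ (X ⁻¹' B) := by
    ext p
    simp [and_comm]
  rw [h2]
  exact measurableSet_predictable_Ioc_prod a b (hX hB)

/-- Simple processes are elementary. -/
def simpleProcToElementary : Γ.SimpleProc T P 𝓕 →ₗ[ℝ] elementary (ℝ≥0 × Ω) d where
  toFun g := ⟨g.1, simpleProcesses_le d T 𝓕 g.2⟩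
  map_add' _ _ := rfl
  map_smul' _ _ := rfl

lemma aestronglyMeasurable_simpleProc (g : Γ.SimpleProc T P 𝓕) :
    AEStronglyMeasurable[𝓕.predictable]
      (Γ.elementaryToL2 (timeProd T P) (Γ.simpleProcToElementary T P 𝓕 g)) (timeProd T P) := by
  refine ⟨_, Γ.stronglyMeasurable_elementaryToH ?_ (simpleProcesses_le d T 𝓕) g.2,
    Γ.coeFn_elementaryToL2 _ _⟩
  rintro _ ⟨a, b, A, X, -, -, hA, hb, hX, -, rfl⟩
  refine ⟨_, A, measurable_predictable_mul 𝓕 (b := b) hX, hA, hb, ?_⟩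
  ext p x
  ring

/-- The simple processes as predictable processes. -/
def simpleProcToL2 : Γ.SimpleProc T P 𝓕 →ₗ[ℝ] Γ.L2Predictable T P 𝓕 :=
  (Γ.elementaryToL2 (timeProd T P) ∘ₗ Γ.simpleProcToElementary T P 𝓕).codRestrict _
    fun g => mem_lpMeas_iff_aestronglyMeasurable.2 (Γ.aestronglyMeasurable_simpleProc T P 𝓕 g)

lemma simpleProcToL2_coe (g : Γ.SimpleProc T P 𝓕) :
    (Γ.simpleProcToL2 T P 𝓕 g).1 =
      Γ.elementaryToL2 (timeProd T P) (Γ.simpleProcToElementary T P 𝓕 g) := rfl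

lemma norm_simpleProcToL2 (g : Γ.SimpleProc T P 𝓕) : ‖Γ.simpleProcToL2 T P 𝓕 g‖ = ‖g‖ := by
  rw [← sq_eq_sq₀ (norm_nonneg _) (norm_nonneg _), ← real_inner_self_eq_norm_sq,
    ← real_inner_self_eq_norm_sq, Submodule.coe_inner, simpleProcToL2_coe, inner_elementaryToL2]
  rfl

/-- Provides completeness of the space of predictable `L²` classes, needed for orthogonal
complements and for the extension to the completion. -/
instance : Fact (𝓕.predictable ≤ (inferInstance : MeasurableSpace (ℝ≥0 × Ω))) :=
  ⟨predictable_le 𝓕⟩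

/-- For two rays the later starting time governs, and both events are measurable there by
monotonicity of the filtration. A rectangle at time `⊥` never meets one over an open ray. -/
lemma isPiSystem_predictable :
    IsPiSystem ({s : Set (ℝ≥0 × Ω) | ∃ A, MeasurableSet[𝓕 ⊥] A ∧ s = {⊥} ×ˢ A} ∪
      {s | ∃ i A, MeasurableSet[𝓕 i] A ∧ s = Set.Ioi i ×ˢ A}) := by
  rintro _ (⟨A, hA, rfl⟩ | ⟨i, A, hA, rfl⟩) _ (⟨B, hB, rfl⟩ | ⟨j, B, hB, rfl⟩) hne
  · exact Or.inl ⟨A ∩ B, hA.inter hB, by rw [Set.prod_inter_prod, Set.inter_self]⟩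
  · obtain ⟨p, hp, hp'⟩ := hne
    exact absurd (hp.1 ▸ hp'.1 : j < ⊥) not_lt_bot
  · obtain ⟨p, hp, hp'⟩ := hne
    exact absurd (hp'.1 ▸ hp.1 : i < ⊥) not_lt_bot
  · exact Or.inr ⟨i ⊔ j, A ∩ B, (𝓕.mono le_sup_left _ hA).inter (𝓕.mono le_sup_right _ hB),
      by rw [Set.prod_inter_prod, Set.Ioi_inter_Ioi]⟩

lemma denseRange_simpleProcToL2 : DenseRange (Γ.simpleProcToL2 T P 𝓕) := by
  refine linearMap_denseRange_of_orthogonal _ fun f hf => ?_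
  have key : ∀ c ∈ Γ.indicatorSet, ∀ (a : ℝ≥0) (B : Set Ω), MeasurableSet[𝓕 a] B →
      ∫ p in Set.Ioi a ×ˢ B, inner ℝ c (f.1 p) ∂timeProd T P = 0 := by
    rintro _ ⟨A, hA, hb, rfl⟩ a B hB
    have hae : (Set.Ioi a ×ˢ B : Set (ℝ≥0 × Ω)) =ᵐ[timeProd T P] Set.Ioc a T ×ˢ B := by
      filter_upwards [ae_timeProd T P] with p hp
      exact propext ⟨fun h => ⟨⟨h.1, hp.2⟩, h.2⟩, fun h => ⟨h.1.1, h.2⟩⟩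
    rw [setIntegral_congr_set hae]
    by_cases haT : a < T
    · have hX : ∀ ω, |B.indicator (fun _ => (1 : ℝ)) ω| ≤ 1 := fun ω => by
        by_cases h : ω ∈ B <;> simp [h]
      rw [← hf ⟨_, Submodule.subset_span ⟨a, T, A, B.indicator fun _ => 1, haT, le_rfl, hA, hb,
        measurable_const.indicator hB, ⟨1, hX⟩, rfl⟩⟩, Submodule.coe_inner]
      refine (Γ.inner_elementaryToL2_indicator f.1 _
        (measurableSet_Ioc.prod (𝓕.le a _ hB)) hA hb ?_).symm
      ext p x
      change (Set.Ioc a T).indicator (fun _ => (1 : ℝ)) p.1 * A.indicator (fun _ => (1 : ℝ)) x *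
        B.indicator (fun _ => (1 : ℝ)) p.2 = _
      by_cases h1 : p.1 ∈ Set.Ioc a T <;> by_cases h2 : p.2 ∈ B <;>
        simp [Set.indicator, Set.mem_prod, h1, h2]
    · rw [Set.Ioc_eq_empty haT]
      simp
  refine Subtype.ext ?_
  refine Γ.Lp_eq_zero_of_piSystem (predictable_le 𝓕) f.1
    (mem_lpMeas_iff_aestronglyMeasurable.1 f.2) Γ.eq_zero_of_inner_indicatorSet rfl
    (isPiSystem_predictable 𝓕) (fun c hc => ?_) ?_
  · rw [← key c hc 0 Set.univ MeasurableSet.univ, ← setIntegral_univ]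
    refine setIntegral_congr_set ?_
    filter_upwards [ae_timeProd T P] with p hp
    exact propext ⟨fun _ => ⟨hp.1, trivial⟩, fun _ => trivial⟩
  · rintro c hc _ (⟨A, -, rfl⟩ | ⟨a, A, hA, rfl⟩)
    -- Simple processes vanish at time `0` and give no information on these generators, but they are
    -- null sets.
    · refine setIntegral_measure_zero _ (measure_mono_null ?_ (ae_iff.1 (ae_timeProd T P)))
      rintro p ⟨hp, -⟩ h
      exact absurd (hp ▸ h.1 : (0 : ℝ≥0) < ⊥) not_lt_bot
    · exact key c hc a A hA

/-! ### Deterministic processes -/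

lemma comp_fst_mem_simpleProcesses {f : ℝ≥0 → Space d → ℝ} (hf : f ∈ simpleFunctions d T) :
    (fun p : ℝ≥0 × Ω => f p.1) ∈ simpleProcesses d T 𝓕 := by
  induction hf using Submodule.span_induction with
  | mem f hf =>
    obtain ⟨a, b, A, hab, hbT, hA, hb, rfl⟩ := hf
    exact Submodule.subset_span ⟨a, b, A, fun _ => 1, hab, hbT, hA, hb, measurable_const,
      ⟨1, fun _ => by simp⟩, by simp⟩
  | zero => exact Submodule.zero_mem _
  | add f g _ _ hf hg => exact Submodule.add_mem _ hf hg
  | smul c f _ hf => exact Submodule.smul_mem _ c hf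

/-- An element of `H_T` as a process that does not depend on `ω`. -/
def detToL2 : Γ.HT T →ₗᵢ[ℝ] Lp Γ.H 2 (timeProd T P) :=
  Lp.compMeasurePreservingₗᵢ ℝ Prod.fst measurePreserving_fst

lemma coeFn_detToL2 (h : Γ.HT T) : Γ.detToL2 T P h =ᵐ[timeProd T P] fun p => h p.1 :=
  Lp.coeFn_compMeasurePreserving h measurePreserving_fst

lemma simpleProcToL2_eq_detToL2 {g : Γ.SimpleProc T P 𝓕} {f : Γ.SimpleDet T}
    (hgf : ∀ t ω z, g (t, ω) z = f t z) :
    (Γ.simpleProcToL2 T P 𝓕 g).1 = Γ.detToL2 T P (Γ.simpleDetToHT T f) := by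
  refine Lp.ext ?_
  have h := Measure.quasiMeasurePreserving_fst (μ := timeMeasure T) (ν := P) |>.ae
    (Γ.coeFn_elementaryToL2 (timeMeasure T) (Γ.simpleDetToElementary T f))
  filter_upwards [Γ.coeFn_elementaryToL2 (timeProd T P) (Γ.simpleProcToElementary T P 𝓕 g), h,
    Γ.coeFn_detToL2 T P (Γ.simpleDetToHT T f)] with p h1 h2 h3
  rw [h3, simpleProcToL2_coe, h1, simpleDetToHT_apply, h2]
  exact congrArg Γ.rapidToH (Subtype.ext (funext fun z => hgf p.1 p.2 z))

/-- `Ψ` transports the question to `L²`, where deterministic processes are the range of `detToL2`.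
One direction is closedness of that range, the other is density of deterministic simple functions in
`H_T`. -/
lemma mem_closure_deterministic_iff {Ψ : Γ.P0 T P 𝓕 ≃ₗᵢ[ℝ] Γ.L2Predictable T P 𝓕}
    (hΨ : ∀ g : Γ.SimpleProc T P 𝓕, Ψ (g : Γ.P0 T P 𝓕) = Γ.simpleProcToL2 T P 𝓕 g)
    (x : Γ.P0 T P 𝓕) :
    x ∈ closure {y | ∃ (g : Γ.SimpleProc T P 𝓕) (f : Γ.SimpleDet T),
        (∀ t ω z, g (t, ω) z = f t z) ∧ y = (g : Γ.P0 T P 𝓕)} ↔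
      ∃ h : Γ.HT T, ∀ᵐ p ∂(timeProd T P), (Ψ x).1 p = h p.1 := by
  have hrange : (∃ h : Γ.HT T, ∀ᵐ p ∂(timeProd T P), (Ψ x).1 p = h p.1) ↔
      (Ψ x).1 ∈ Set.range (Γ.detToL2 T P) := by
    refine exists_congr fun h => ⟨fun hx => Lp.ext ?_, fun hx => ?_⟩
    · filter_upwards [hx, Γ.coeFn_detToL2 T P h] with p h1 h2
      rw [h1, h2]
    · rw [← hx]
      exact Γ.coeFn_detToL2 T P h
  rw [hrange]
  constructor
  · intro hx
    have hclosed : IsClosed {y : Γ.P0 T P 𝓕 | (Ψ y).1 ∈ Set.range (Γ.detToL2 T P)} :=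
      (Γ.detToL2 T P).isometry.isClosedEmbedding.isClosed_range.preimage
        (continuous_subtype_val.comp Ψ.continuous)
    refine closure_minimal ?_ hclosed hx
    rintro _ ⟨g, f, hgf, rfl⟩
    refine ⟨Γ.simpleDetToHT T f, ?_⟩
    rw [hΨ, Γ.simpleProcToL2_eq_detToL2 T P 𝓕 hgf]
  · rintro ⟨h, hh⟩
    -- Approximate `h` in `H_T`, view the approximants as processes constant in `ω`, and return to
    -- `P_0` by the continuous inverse of `Ψ`.
    obtain ⟨u, hu, hlim⟩ := mem_closure_iff_seq_limit.1 (Γ.denseRange_simpleDetToHT T h)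
    choose f hf using hu
    let g : ℕ → Γ.SimpleProc T P 𝓕 := fun n =>
      ⟨fun p => f n p.1, comp_fst_mem_simpleProcesses T 𝓕 (f n).2⟩
    have hg : ∀ n t ω z, g n (t, ω) z = f n t z := fun _ _ _ _ => rfl
    have h1 : Tendsto (fun n => (Ψ (g n : Γ.P0 T P 𝓕)).1) atTop (𝓝 (Ψ x).1) := by
      rw [← hh]
      refine (((Γ.detToL2 T P).continuous.tendsto h).comp hlim).congr fun n => ?_
      rw [hΨ, Γ.simpleProcToL2_eq_detToL2 T P 𝓕 (hg n), hf, Function.comp_apply]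
    have h2 : Tendsto (fun n => Ψ (g n : Γ.P0 T P 𝓕)) atTop (𝓝 (Ψ x)) :=
      tendsto_subtype_rng.2 h1
    have h3 : Tendsto (fun n => (g n : Γ.P0 T P 𝓕)) atTop (𝓝 x) := by
      simpa [Function.comp_def] using (Ψ.symm.continuous.tendsto _).comp h2
    exact mem_closure_of_tendsto h3 (Eventually.of_forall fun n => ⟨g n, f n, hg n, rfl⟩)

end

end SpatialCovariance

end SpatialNoise

end

/-! ### The two identifications -/

theorem lemma2p1 {d : ℕ} (Γ : SpatialNoise.SpatialCovariance d) (T : ℝ≥0) (hT : 0 < T)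
    {Ω : Type*} {mΩ : MeasurableSpace Ω} (P : Measure Ω) [IsProbabilityMeasure P]
    (𝓕 : Filtration ℝ≥0 mΩ) :
    -- `P_{0,d} = H_T`
    (∃! Φ : Γ.P0Det T ≃ₗᵢ[ℝ] Γ.HT T,
      ∀ (g : Γ.SimpleDet T) (φ : 𝓢(SpatialNoise.Space d, ℝ)),
        ∀ᵐ t ∂(SpatialNoise.timeMeasure T),
          inner ℝ ((Φ (g : Γ.P0Det T) : Γ.HT T) t) (Γ.ofSchwartz φ) = Γ.form (g t) φ) ∧
    -- `P_0` = predictable processes in `L²([0,T] × Ω; H)`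
    ∃ Ψ : Γ.P0 T P 𝓕 ≃ₗᵢ[ℝ] Γ.L2Predictable T P 𝓕,
      (∀ (g : Γ.SimpleProc T P 𝓕) (φ : 𝓢(SpatialNoise.Space d, ℝ)),
        ∀ᵐ p ∂(SpatialNoise.SpatialCovariance.timeProd T P),
          inner ℝ ((Ψ (g : Γ.P0 T P 𝓕)).1 p) (Γ.ofSchwartz φ) = Γ.form (g p) φ) ∧
      (∀ Ψ' : Γ.P0 T P 𝓕 ≃ₗᵢ[ℝ] Γ.L2Predictable T P 𝓕,
        (∀ (g : Γ.SimpleProc T P 𝓕) (φ : 𝓢(SpatialNoise.Space d, ℝ)),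
          ∀ᵐ p ∂(SpatialNoise.SpatialCovariance.timeProd T P),
            inner ℝ ((Ψ' (g : Γ.P0 T P 𝓕)).1 p) (Γ.ofSchwartz φ) = Γ.form (g p) φ) → Ψ' = Ψ) ∧
      -- the deterministic elements of `P_0` are the elements of `H_T`
      (∀ x : Γ.P0 T P 𝓕,
        x ∈ closure {y | ∃ (g : Γ.SimpleProc T P 𝓕) (f : Γ.SimpleDet T),
            (∀ t ω z, g (t, ω) z = f t z) ∧ y = (g : Γ.P0 T P 𝓕)} ↔
          ∃ h : Γ.HT T, ∀ᵐ p ∂(SpatialNoise.SpatialCovariance.timeProd T P),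
            (Ψ x).1 p = h p.1) := by
  open SpatialNoise SpatialCovariance in
  constructor
  · obtain ⟨Φ, hΦ⟩ := exists_completion_equiv (Γ.simpleDetToHT T) (Γ.norm_simpleDetToHT T)
      (Γ.denseRange_simpleDetToHT T)
    have hΦ' : ∀ (g : Γ.SimpleDet T) (φ : 𝓢(Space d, ℝ)), ∀ᵐ t ∂(timeMeasure T),
        inner ℝ ((Φ (g : Γ.P0Det T) : Γ.HT T) t) (Γ.ofSchwartz φ) = Γ.form (g t) φ := by
      intro g φ
      rw [hΦ]
      exact Γ.inner_elementaryToL2_ofSchwartz _ (Γ.simpleDetToElementary T g) φ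
    -- A competitor has the same inner products with Schwartz elements on simple functions, hence
    -- agrees there and, by density, everywhere.
    refine ⟨Φ, hΦ', fun Φ₂ hΦ₂ => completion_equiv_ext fun g => Γ.Lp_ext_ofSchwartz fun φ => ?_⟩
    filter_upwards [hΦ' g φ, hΦ₂ g φ] with t h1 h2
    rw [h1, h2]
  · obtain ⟨Ψ, hΨ⟩ := exists_completion_equiv (Γ.simpleProcToL2 T P 𝓕)
      (Γ.norm_simpleProcToL2 T P 𝓕) (Γ.denseRange_simpleProcToL2 T P 𝓕)
    have hΨ' : ∀ (g : Γ.SimpleProc T P 𝓕) (φ : 𝓢(Space d, ℝ)), ∀ᵐ p ∂(timeProd T P),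
        inner ℝ ((Ψ (g : Γ.P0 T P 𝓕)).1 p) (Γ.ofSchwartz φ) = Γ.form (g p) φ := by
      intro g φ
      rw [hΨ]
      exact Γ.inner_elementaryToL2_ofSchwartz _ (Γ.simpleProcToElementary T P 𝓕 g) φ
    refine ⟨Ψ, hΨ', fun Ψ₂ hΨ₂ => completion_equiv_ext fun g => Subtype.ext
      (Γ.Lp_ext_ofSchwartz fun φ => ?_), Γ.mem_closure_deterministic_iff T P 𝓕 hΨ⟩
    filter_upwards [hΨ' g φ, hΨ₂ g φ] with p h1 h2
    rw [h1, h2]
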